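/- Let $K$ be an algebraically closed field with a derivation $\delta : K \to K$, and let $e \in K$ satisfy $\delta(e) = 1$. Let $X$ be a smooth variety over $K$, that is, an integral, separated, smooth $K$-scheme of finite type, with structure morphism $f : X \to \operatorname{Spec} K$. For a $K$-algebra $R$, let $\Omega^\tau_R$ be the $R$-module generated by symbols $\tau r$ ($r \in R$) subject to $\tau(r+s) = \tau r + \tau s$, $\tau(rs) = r\,\tau s + s\,\tau r$, and $\delta(a)\,\tau b = \delta(b)\,\tau a$ for $a, b \in K$ (images of $a,b$ in $R$). Let $\Omega^\tau_X$ be the sheaf of $\mathcal O_X$-modules associated to $U \mapsto \Omega^\tau_{\mathcal O_X(U)}$. Let $\Omega_X$, $\Omega_{X/K}$ and $\Omega_K$ be the absolute differentials of $X$, the differentials of $X$ relative to $K$, and the absolute differentials of $K$, and let $\Theta_{X/K} = \mathcal{H}om(\Omega_{X/K}, \mathcal O_X)$. Then: 1. The sequences of $\mathcal O_X$-modules $$0 \to \mathcal O_X \xrightarrow{\ r \mapsto r\,\tau e\ } \Omega^\tau_X \xrightarrow{\ \tau r \mapsto dr\ } \Omega_{X/K} \to 0 \qquad\text{and}\qquad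 0 \to f^*\Omega_K \to \Omega_X \to \Omega_{X/K} \to 0$$ are exact. 2. The class of the first extension in $\operatorname{Ext}^1(\Omega_{X/K}, \mathcal O_X)$ equals the Kodaira–Spencer class of $X$ in $\operatorname{Ext}^1(\Omega_{X/K}, \mathcal O_X)$, that is, the image of the map $f^*\Omega_K \to \mathcal O_X$, $r \otimes da \mapsto r\,\delta(a)$, under the connecting map $\operatorname{Hom}(f^*\Omega_K, \mathcal O_X) \to \operatorname{Ext}^1(\Omega_{X/K}, \mathcal O_X)$ of the second sequence. 3. There is a unique group isomorphism $\Phi : \operatorname{Ext}^1(\Omega_{X/K}, \mathcal O_X) \to H^1(X, \Theta_{X/K})$ with the following property: whenever an extension $E$ of $\Omega_{X/K}$ by $\mathcal O_X$ has splittings $s_i : \Omega_{X/K}|_{U_i} \to E|_{U_i}$ over an open cover $(U_i)$ of $X$, $\Phi$ sends the class of $E$ to the class of the Čech cocycle $(s_j - s_i)_{i,j}$. 4. Under $\Phi$, the class of the extension $\Omega^\tau_X$ is Buium's Kodaira–Spencer class of $X$: a class $h \in H^1(X, \Theta_{X/K})$ equals $\Phi([\Omega^\tau_X])$ if and only if there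 are an open cover $(U_i)$ of $X$ and derivations $D_i$ of the sheaf of rings $\mathcal O_X|_{U_i}$ lifting $\delta$ such that $h$ is the class of the Čech cocycle $(D_i - D_j)_{i,j}$, where the $K$-linear derivation $D_i - D_j$ of $\mathcal O_X|_{U_i \cap U_j}$ is viewed as a section of $\Theta_{X/K}$. -/

import Mathlib

open CategoryTheory AlgebraicGeometry TopologicalSpace Opposite
open scoped KaehlerDifferential TensorProduct
universe u
namespace TauKS

noncomputable section

section Algebra

/-- The map `Ω[R⁄k] → Ω[S⁄k]`, `a db ↦ g(a) d(g b)`, induced by a `k`-algebra map `g : R → S`. -/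
def kaehlerMap {k R S : Type*} [CommRing k] [CommRing R] [CommRing S] [Algebra k R] [Algebra k S]
    (g : R →ₐ[k] S) : Ω[R⁄k] →ₛₗ[(g : R →+* S)] Ω[S⁄k] :=
  letI := (g : R →+* S).toAlgebra
  haveI : IsScalarTower k R S := IsScalarTower.of_algebraMap_eq fun x => (g.commutes x).symm
  { toFun := KaehlerDifferential.map k k R S
    map_add' := map_add _
    map_smul' := fun r x => by
      rw [map_smul]; exact (algebraMap_smul S r _).symm }

theorem kaehlerMap_D {k R S : Type*} [CommRing k] [CommRing R] [CommRing S] [Algebra k R]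
    [Algebra k S] (g : R →ₐ[k] S) (r : R) :
    kaehlerMap g (KaehlerDifferential.D k R r) = KaehlerDifferential.D k S (g r) := by
  let := (g : R →+* S).toAlgebra
  have : IsScalarTower k R S := IsScalarTower.of_algebraMap_eq fun x => (g.commutes x).symm
  exact KaehlerDifferential.map_D k k R S r

theorem kaehler_induction {k R : Type*} [CommRing k] [CommRing R] [Algebra k R]
    {p : Ω[R⁄k] → Prop} (hD : ∀ r, p (KaehlerDifferential.D k R r))
    (hadd : ∀ x y, p x → p y → p (x + y)) (hsmul : ∀ (r : R) x, p x → p (r • x)) (x) : p x := by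
  have hx : x ∈ Submodule.span R (Set.range (KaehlerDifferential.D k R)) := by
    rw [KaehlerDifferential.span_range_derivation]; trivial
  induction hx using Submodule.span_induction with
  | mem x h => obtain ⟨r, rfl⟩ := h; exact hD r
  | zero => simpa using hD 0
  | add x y _ _ hx hy => exact hadd x y hx hy
  | smul r x _ hx => exact hsmul r x hx

theorem kaehlerMap_eq_self {k R : Type*} [CommRing k] [CommRing R] [Algebra k R] (g : R →ₐ[k] R)
    (hg : ∀ r, g r = r) (x : Ω[R⁄k]) : kaehlerMap g x = x := by
  induction x using kaehler_induction with
  | hD r => rw [kaehlerMap_D, hg]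
  | hadd x y hx hy => rw [map_add, hx, hy]
  | hsmul r x hx => rw [map_smulₛₗ, hx]; congr 1; exact hg r

theorem kaehlerMap_comp {k R S T : Type*} [CommRing k] [CommRing R] [CommRing S] [CommRing T]
    [Algebra k R] [Algebra k S] [Algebra k T] (g : R →ₐ[k] S) (h : S →ₐ[k] T) (f : R →ₐ[k] T)
    (hf : ∀ r, f r = h (g r)) (x : Ω[R⁄k]) : kaehlerMap f x = kaehlerMap h (kaehlerMap g x) := by
  induction x using kaehler_induction with
  | hD r => rw [kaehlerMap_D, kaehlerMap_D, kaehlerMap_D, hf]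
  | hadd x y hx hy => simp only [map_add, hx, hy]
  | hsmul r x hx => rw [map_smulₛₗ, map_smulₛₗ, map_smulₛₗ, hx]; congr 1; exact hf r

variable {K : Type u} [Field K] (δ : Derivation ℤ K K)
variable {R S : Type u} [CommRing R] [CommRing S] [Algebra K R] [Algebra K S]

variable (R) in
/-- The relations `δ(a) db = δ(b) da` (`a, b ∈ K`) in the module of absolute differentials. -/
def tauRelations : Submodule R (Ω[R⁄ℤ]) :=
  Submodule.span R (Set.range fun p : K × K =>
    algebraMap K R (δ p.1) • KaehlerDifferential.D ℤ R (algebraMap K R p.2) -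
      algebraMap K R (δ p.2) • KaehlerDifferential.D ℤ R (algebraMap K R p.1))

variable (R) in
/-- The module `Ω^τ_{R/K}` of `τ`-differentials: the `R`-module generated by symbols `τr` that are
additive, satisfy the Leibniz rule, and satisfy `δ(a) τb = δ(b) τa` for `a, b ∈ K`. The first two
families of relations define the module `Ω[R⁄ℤ]` of absolute differentials. -/
abbrev TauDifferential : Type u := Ω[R⁄ℤ] ⧸ tauRelations δ R

variable (R) in
/-- The projection from absolute differentials to `τ`-differentials, `da ↦ τa`. -/
abbrev tauProj : Ω[R⁄ℤ] →ₗ[R] TauDifferential δ R := (tauRelations δ R).mkQ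

/-- The universal `τ`-derivation. -/
def tau (r : R) : TauDifferential δ R := tauProj δ R (KaehlerDifferential.D ℤ R r)

/-- The map `Ω^τ_{R/K} → Ω^τ_{S/K}`, `a τb ↦ g(a) τ(g b)`, induced by `g : R → S`. -/
def tauMap (g : R →ₐ[K] S) : TauDifferential δ R →ₛₗ[(g : R →+* S)] TauDifferential δ S :=
  (tauRelations δ R).mapQ (tauRelations δ S) (kaehlerMap ((g : R →+* S).toIntAlgHom)) (by
    rw [tauRelations, Submodule.span_le]
    rintro _ ⟨p, rfl⟩
    refine Submodule.subset_span ⟨p, ?_⟩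
    change algebraMap K S (δ p.1) • KaehlerDifferential.D ℤ S (algebraMap K S p.2) -
      algebraMap K S (δ p.2) • KaehlerDifferential.D ℤ S (algebraMap K S p.1) = kaehlerMap _ _
    rw [map_sub, map_smulₛₗ, map_smulₛₗ, kaehlerMap_D, kaehlerMap_D]
    simp [-algebraMap_smul])

variable (R) in
/-- The map `Ω^τ_{R/K} → Ω_{R/K}`, `τr ↦ dr`. -/
def tauToRel : TauDifferential δ R →ₗ[R] Ω[R⁄K] :=
  (tauRelations δ R).liftQ (KaehlerDifferential.map ℤ K R R) (by
    rw [tauRelations, Submodule.span_le]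
    rintro _ ⟨p, rfl⟩
    simp)

variable (R) in
/-- The map `R → Ω^τ_{R/K}`, `r ↦ r τe`. -/
def unitToTau (e : K) : R →ₗ[R] TauDifferential δ R :=
  LinearMap.toSpanSingleton R _ (tau δ (algebraMap K R e))

variable (K R) in
/-- The map `R ⊗_K Ω_K → Ω_R`, `r ⊗ da ↦ r da`. -/
def baseToAbs : R ⊗[K] Ω[K⁄ℤ] →ₗ[R] Ω[R⁄ℤ] := KaehlerDifferential.mapBaseChange ℤ K R

variable (R) in
/-- The map `R ⊗_K Ω_K → R`, `r ⊗ da ↦ r δ(a)`. -/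
def contract : R ⊗[K] Ω[K⁄ℤ] →ₗ[R] R :=
  LinearMap.liftBaseChange R (Algebra.linearMap K R ∘ₗ δ.liftKaehlerDifferential)

/-- The map `R ⊗_K Ω_K → S ⊗_K Ω_K` induced by a `K`-algebra map `R → S`. -/
def baseMap (g : R →ₐ[K] S) : R ⊗[K] Ω[K⁄ℤ] →ₛₗ[(g : R →+* S)] S ⊗[K] Ω[K⁄ℤ] where
  toFun := TensorProduct.map g.toLinearMap LinearMap.id
  map_add' := map_add _
  map_smul' r x := by
    induction x with
    | zero => simp
    | add x y hx hy => simp only [smul_add, map_add, hx, hy]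
    | tmul a b => simp [TensorProduct.smul_tmul']

theorem tauMap_eq_self (g : R →ₐ[K] R) (hg : ∀ r, g r = r) (x : TauDifferential δ R) :
    tauMap δ g x = x := by
  obtain ⟨x, rfl⟩ := Submodule.Quotient.mk_surjective _ x
  exact congrArg _ (kaehlerMap_eq_self (g : R →+* R).toIntAlgHom hg x)

theorem tauMap_comp {T : Type u} [CommRing T] [Algebra K T] (g : R →ₐ[K] S) (h : S →ₐ[K] T)
    (f : R →ₐ[K] T) (hf : ∀ r, f r = h (g r)) (x : TauDifferential δ R) :
    tauMap δ f x = tauMap δ h (tauMap δ g x) := by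
  obtain ⟨x, rfl⟩ := Submodule.Quotient.mk_surjective _ x
  exact congrArg _ (kaehlerMap_comp (g : R →+* S).toIntAlgHom (h : S →+* T).toIntAlgHom
    (f : R →+* T).toIntAlgHom hf x)

theorem baseMap_eq_self (g : R →ₐ[K] R) (hg : ∀ r, g r = r) (x : R ⊗[K] Ω[K⁄ℤ]) :
    baseMap g x = x := by
  induction x with
  | zero => rw [map_zero]
  | add x y hx hy => rw [map_add, hx, hy]
  | tmul a b => exact congrArg (· ⊗ₜ[K] b) (hg a)

theorem baseMap_comp {T : Type u} [CommRing T] [Algebra K T] (g : R →ₐ[K] S) (h : S →ₐ[K] T)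
    (f : R →ₐ[K] T) (hf : ∀ r, f r = h (g r)) (x : R ⊗[K] Ω[K⁄ℤ]) :
    baseMap f x = baseMap h (baseMap g x) := by
  induction x with
  | zero => simp only [map_zero]
  | add x y hx hy => simp only [map_add, hx, hy]
  | tmul a b => exact congrArg (· ⊗ₜ[K] b) (hf a)

theorem tauProj_natural (g : R →ₐ[K] S) (x : Ω[R⁄ℤ]) :
    tauProj δ S (kaehlerMap (g : R →+* S).toIntAlgHom x) = tauMap δ g (tauProj δ R x) := rfl

theorem map_natural {k R S : Type*} [CommRing k] [CommRing R] [CommRing S] [Algebra k R]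
    [Algebra k S] (g : R →ₐ[k] S) (x : Ω[R⁄ℤ]) :
    KaehlerDifferential.map ℤ k S S (kaehlerMap (g : R →+* S).toIntAlgHom x) =
      kaehlerMap g (KaehlerDifferential.map ℤ k R R x) := by
  induction x using kaehler_induction with
  | hD r =>
    rw [kaehlerMap_D, KaehlerDifferential.map_D, KaehlerDifferential.map_D]
    exact (kaehlerMap_D g r).symm
  | hadd x y hx hy => simp only [map_add, hx, hy]
  | hsmul r x hx => rw [map_smulₛₗ, map_smul, map_smul, map_smulₛₗ, hx]; rfl

theorem tauToRel_natural (g : R →ₐ[K] S) (x : TauDifferential δ R) :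
    tauToRel δ S (tauMap δ g x) = kaehlerMap g (tauToRel δ R x) := by
  obtain ⟨x, rfl⟩ := Submodule.Quotient.mk_surjective _ x
  exact map_natural g x

theorem unitToTau_natural (e : K) (g : R →ₐ[K] S) (r : R) :
    unitToTau δ S e (g r) = tauMap δ g (unitToTau δ R e r) := by
  simp only [unitToTau, LinearMap.toSpanSingleton_apply, map_smulₛₗ, tau, ← tauProj_natural,
    kaehlerMap_D]
  simp

theorem baseToAbs_natural (g : R →ₐ[K] S) (x : R ⊗[K] Ω[K⁄ℤ]) :
    baseToAbs K S (baseMap g x) = kaehlerMap (g : R →+* S).toIntAlgHom (baseToAbs K R x) := by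
  induction x with
  | zero => simp only [map_zero]
  | add x y hx hy => simp only [map_add, hx, hy]
  | tmul a b =>
    change KaehlerDifferential.mapBaseChange ℤ K S (g a ⊗ₜ b) =
      kaehlerMap _ (KaehlerDifferential.mapBaseChange ℤ K R (a ⊗ₜ b))
    rw [KaehlerDifferential.mapBaseChange_tmul, KaehlerDifferential.mapBaseChange_tmul,
      map_smulₛₗ]
    congr 1
    induction b using kaehler_induction with
    | hD r =>
      rw [KaehlerDifferential.map_D, KaehlerDifferential.map_D, kaehlerMap_D]
      exact congrArg _ (g.commutes r).symm
    | hadd x y hx hy => simp only [map_add, hx, hy]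
    | hsmul r x hx =>
      rw [map_smul, map_smul, hx, ← algebraMap_smul R r (KaehlerDifferential.map ℤ ℤ K R x),
        ← algebraMap_smul S r, map_smulₛₗ]
      congr 1
      exact (g.commutes r).symm

theorem contract_natural (g : R →ₐ[K] S) (x : R ⊗[K] Ω[K⁄ℤ]) :
    contract δ S (baseMap g x) = g (contract δ R x) := by
  induction x with
  | zero => simp only [map_zero]
  | add x y hx hy => simp only [map_add, hx, hy]
  | tmul a b =>
    change contract δ S (g a ⊗ₜ b) = _
    simp [contract]

theorem tauToRel_unitToTau (e : K) (r : R) : tauToRel δ R (unitToTau δ R e r) = 0 := by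
  rw [unitToTau, LinearMap.toSpanSingleton_apply, map_smul]
  change r • KaehlerDifferential.map ℤ K R R (KaehlerDifferential.D ℤ R (algebraMap K R e)) = 0
  simp

theorem absToRel_baseToAbs (x : R ⊗[K] Ω[K⁄ℤ]) :
    KaehlerDifferential.map ℤ K R R (baseToAbs K R x) = 0 := by
  induction x with
  | zero => simp only [map_zero]
  | add x y hx hy => simp only [map_add, hx, hy, add_zero]
  | tmul a b =>
    change KaehlerDifferential.map ℤ K R R (KaehlerDifferential.mapBaseChange ℤ K R (a ⊗ₜ b)) = 0
    rw [KaehlerDifferential.mapBaseChange_tmul, map_smul]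
    induction b using kaehler_induction with
    | hD r => simp
    | hadd x y hx hy => simp only [map_add, smul_add, hx, hy, add_zero]
    | hsmul r x hx =>
      rw [map_smul, ← algebraMap_smul R r (KaehlerDifferential.map ℤ ℤ K R x), map_smul,
        smul_comm, hx, smul_zero]

end Algebra


section Sheaves

variable {X : Scheme.{u}}

/-- A presheaf of modules on `X` from modules `M U` over `Γ(X, U)` and semilinear restrictions. -/
def mkPresheaf (M : X.Opens → Type u) [∀ U, AddCommGroup (M U)] [∀ U, Module Γ(X, U) (M U)]
    (res : ∀ {U V : X.Opens} (h : V ≤ U), M U →ₛₗ[(X.presheaf.map (homOfLE h).op).hom] M V)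
    (res_id : ∀ (U : X.Opens) (m : M U), res le_rfl m = m)
    (res_comp : ∀ {U V W : X.Opens} (h : V ≤ U) (h' : W ≤ V) (m : M U),
      res (h'.trans h) m = res h' (res h m)) : X.PresheafOfModules where
  obj U := ModuleCat.of Γ(X, U.unop) (M U.unop)
  map {U V} i := ModuleCat.semilinearMapAddEquiv _ _ _ (res (leOfHom i.unop))
  map_id U := by
    ext m; exact res_id _ _
  map_comp i j := by
    ext m; exact res_comp _ _ _

/-- A morphism of presheaves of modules from linear maps commuting with restrictions. -/
def mkPresheafHom {M N : X.Opens → Type u}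
    [∀ U, AddCommGroup (M U)] [∀ U, Module Γ(X, U) (M U)]
    [∀ U, AddCommGroup (N U)] [∀ U, Module Γ(X, U) (N U)]
    {r : ∀ {U V : X.Opens} (h : V ≤ U), M U →ₛₗ[(X.presheaf.map (homOfLE h).op).hom] M V}
    {r_id r_comp}
    {s : ∀ {U V : X.Opens} (h : V ≤ U), N U →ₛₗ[(X.presheaf.map (homOfLE h).op).hom] N V}
    {s_id s_comp} (l : ∀ U, M U →ₗ[Γ(X, U)] N U)
    (hl : ∀ {U V : X.Opens} (h : V ≤ U) (m : M U), l V (r h m) = s h (l U m)) :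
    mkPresheaf M r r_id r_comp ⟶ mkPresheaf N s s_id s_comp where
  app U := ModuleCat.ofHom (l U.unop)
  naturality i := by
    ext m; exact hl (leOfHom i.unop) m

/-- The sheaf of modules associated to a presheaf of modules. -/
def sheafify : X.PresheafOfModules ⥤ X.Modules :=
  PresheafOfModules.sheafification (𝟙 X.ringCatSheaf.obj)

/-- Sheafification is left adjoint to the inclusion of sheaves into presheaves. -/
def sheafifyAdj : sheafify ⊣ Scheme.Modules.toPresheafOfModules X :=
  PresheafOfModules.sheafificationAdjunction (𝟙 X.ringCatSheaf.obj)

/-- The canonical map from a presheaf of modules to the associated sheaf. -/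
def toSheafify (P : X.PresheafOfModules) :
    P ⟶ (Scheme.Modules.toPresheafOfModules X).obj (sheafify.obj P) :=
  sheafifyAdj.unit.app P

/-- The map from the associated sheaf induced by a map from a presheaf to a sheaf. -/
def sheafifyDesc {P : X.PresheafOfModules} {M : X.Modules}
    (f : P ⟶ (Scheme.Modules.toPresheafOfModules X).obj M) : sheafify.obj P ⟶ M :=
  (sheafifyAdj.homEquiv P M).symm f

theorem sheafify_map_zero (P Q : X.PresheafOfModules) :
    sheafify.map (0 : P ⟶ Q) = 0 := by
  have : (sheafify (X := X)).IsLeftAdjoint := sheafifyAdj.isLeftAdjoint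
  exact sheafify.map_zero P Q

theorem toPresheaf_map_zero (M N : X.Modules) :
    (Scheme.Modules.toPresheafOfModules X).map (0 : M ⟶ N) = 0 := rfl

variable (X) in
/-- The structure sheaf as a sheaf of modules. -/
def structureSheaf : X.Modules := SheafOfModules.unit X.ringCatSheaf

variable {K : Type u} [Field K] [X.Over (Spec (CommRingCat.of K))]

/-- The `K`-algebra structure on the sections over an open subset of a `K`-scheme. -/
instance sectionsAlgebra (U : X.Opens) : Algebra K Γ(X, U) :=
  ((Scheme.ΓSpecIso (.of K)).inv ≫ (X ↘ Spec (.of K)).appTop ≫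
    X.presheaf.map (homOfLE le_top).op).hom.toAlgebra

variable (K) in
/-- Restriction of functions, as a homomorphism of `K`-algebras. -/
def resAlgHom {U V : X.Opens} (h : V ≤ U) : Γ(X, U) →ₐ[K] Γ(X, V) :=
  { (X.presheaf.map (homOfLE h).op).hom with
    commutes' := fun a => by
      change (X.presheaf.map (homOfLE h).op).hom ((X.presheaf.map _).hom _) =
        (X.presheaf.map _).hom _
      rw [← CommRingCat.comp_apply, ← Functor.map_comp]; rfl }

theorem resAlgHom_self {U : X.Opens} (a : Γ(X, U)) : resAlgHom K (le_refl U) a = a :=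
  congr($(X.presheaf.map_id (op U)) a)

theorem resAlgHom_trans {U V W : X.Opens} (h : V ≤ U) (h' : W ≤ V) (a : Γ(X, U)) :
    resAlgHom K (h'.trans h) a = resAlgHom K h' (resAlgHom K h a) :=
  congr($(X.presheaf.map_comp (homOfLE h).op (homOfLE h').op) a)

variable (δ : Derivation ℤ K K)

variable (X K)

/-- The presheaf `U ↦ Ω_{𝒪(U)}` of absolute differentials. -/
def absPresheaf (X : Scheme.{u}) : X.PresheafOfModules :=
  mkPresheaf (fun U => Ω[Γ(X, U)⁄ℤ])
    (fun h => kaehlerMap ((X.presheaf.map (homOfLE h).op).hom).toIntAlgHom)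
    (fun _ => kaehlerMap_eq_self _ fun a => congr($(X.presheaf.map_id _) a))
    (fun _ _ => kaehlerMap_comp _ _ _ fun a => congr($(X.presheaf.map_comp _ _) a))

/-- The presheaf `U ↦ Ω_{𝒪(U)/K}`. -/
def relPresheaf : X.PresheafOfModules :=
  mkPresheaf (fun U => Ω[Γ(X, U)⁄K]) (fun h => kaehlerMap (resAlgHom K h))
    (fun _ => kaehlerMap_eq_self _ resAlgHom_self)
    (fun h h' => kaehlerMap_comp _ _ _ (resAlgHom_trans h h'))

/-- The presheaf `U ↦ 𝒪(U) ⊗_K Ω_K`. -/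
def basePresheaf : X.PresheafOfModules :=
  mkPresheaf (fun U => Γ(X, U) ⊗[K] Ω[K⁄ℤ]) (fun h => baseMap (resAlgHom K h))
    (fun _ => baseMap_eq_self _ resAlgHom_self)
    (fun h h' => baseMap_comp _ _ _ (resAlgHom_trans h h'))

variable {K}

/-- The presheaf `U ↦ Ω^τ_{𝒪(U)/K}`. -/
def tauPresheaf : X.PresheafOfModules :=
  mkPresheaf (fun U => TauDifferential δ Γ(X, U)) (fun h => tauMap δ (resAlgHom K h))
    (fun _ => tauMap_eq_self δ _ resAlgHom_self)
    (fun h h' => tauMap_comp δ _ _ _ (resAlgHom_trans h h'))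

variable (K) in
/-- `r ⊗ da ↦ r da` -/
def baseToAbsPresheaf : basePresheaf X K ⟶ absPresheaf X :=
  mkPresheafHom (fun U => baseToAbs K Γ(X, U)) (fun h => baseToAbs_natural (resAlgHom K h))

variable (K) in
/-- `dr ↦ dr` -/
def absToRelPresheaf : absPresheaf X ⟶ relPresheaf X K :=
  mkPresheafHom (fun U => KaehlerDifferential.map ℤ K Γ(X, U) Γ(X, U))
    (fun h => map_natural (resAlgHom K h))

/-- `τr ↦ dr` -/
def tauToRelPresheaf : tauPresheaf X δ ⟶ relPresheaf X K :=
  mkPresheafHom (fun U => tauToRel δ Γ(X, U)) (fun h => tauToRel_natural δ (resAlgHom K h))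

/-- The structure sheaf as a presheaf of modules. -/
def unitPresheaf : X.PresheafOfModules :=
  (Scheme.Modules.toPresheafOfModules X).obj (structureSheaf X)

/-- `r ↦ r τe` -/
def unitToTauPresheaf (e : K) : unitPresheaf X ⟶ tauPresheaf X δ where
  app U := (ModuleCat.ofHom (unitToTau δ Γ(X, U.unop) e) : ModuleCat.of Γ(X, U.unop) Γ(X, U.unop) ⟶
    ModuleCat.of Γ(X, U.unop) (TauDifferential δ Γ(X, U.unop)))
  naturality i := by
    refine ModuleCat.hom_ext (LinearMap.ext fun m => ?_)
    exact (unitToTau_natural δ e (resAlgHom K (leOfHom i.unop)) m)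

/-- `r ⊗ da ↦ r δ(a)` -/
def contractPresheaf : basePresheaf X K ⟶ unitPresheaf X where
  app U := (ModuleCat.ofHom (contract δ Γ(X, U.unop)) :
    ModuleCat.of Γ(X, U.unop) (Γ(X, U.unop) ⊗[K] Ω[K⁄ℤ]) ⟶
    ModuleCat.of Γ(X, U.unop) Γ(X, U.unop))
  naturality i := by
    refine ModuleCat.hom_ext (LinearMap.ext fun m => ?_)
    exact contract_natural δ (resAlgHom K (leOfHom i.unop)) m

end Sheaves
section LocalHom

variable {X : Scheme.{u}}

/-- Restriction of sections of a sheaf of modules. -/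
def res (M : X.Modules) {U V : X.Opens} (h : V ≤ U) (m : Γ(M, U)) : Γ(M, V) :=
  M.presheaf.map (homOfLE h).op m

theorem res_self (M : X.Modules) {U : X.Opens} (m : Γ(M, U)) : res M le_rfl m = m :=
  congr($(M.presheaf.map_id (op U)) m)

theorem res_res (M : X.Modules) {U V W : X.Opens} (h : V ≤ U) (h' : W ≤ V) (m : Γ(M, U)) :
    res M h' (res M h m) = res M (h'.trans h) m :=
  congr($(M.presheaf.map_comp (homOfLE h).op (homOfLE h').op) m).symm

theorem res_add (M : X.Modules) {U V : X.Opens} (h : V ≤ U) (m n : Γ(M, U)) :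
    res M h (m + n) = res M h m + res M h n := map_add _ _ _

theorem res_smul (M : X.Modules) {U V : X.Opens} (h : V ≤ U) (a : Γ(X, U)) (m : Γ(M, U)) :
    res M h (a • m) = X.presheaf.map (homOfLE h).op a • res M h m :=
  Scheme.Modules.map_smul M (homOfLE h) a m

/-- The group of morphisms of `𝒪_U`-modules `M|_U ⟶ N|_U`: families of `𝒪(V)`-linear maps
`M(V) → N(V)`, for `V ⊆ U` open, that commute with restriction. -/
def localHoms (M N : X.Modules) (U : X.Opens) :
    AddSubgroup (∀ V : {V : X.Opens // V ≤ U}, Γ(M, V.1) →ₗ[Γ(X, V.1)] Γ(N, V.1)) where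
  carrier := {φ | ∀ (V W : {V : X.Opens // V ≤ U}) (h : W.1 ≤ V.1) (m : Γ(M, V.1)),
    res N h (φ V m) = φ W (res M h m)}
  zero_mem' V W h m := map_zero _
  add_mem' {φ ψ} hφ hψ V W h m := by
    change res N h (φ V m + ψ V m) = φ W _ + ψ W _
    rw [res_add, hφ V W h, hψ V W h]
  neg_mem' {φ} hφ V W h m := by
    change res N h (-(φ V m)) = -(φ W _)
    rw [← hφ V W h]; exact map_neg _ _

/-- The type of morphisms `M|_U ⟶ N|_U`. -/
abbrev LocalHom (M N : X.Modules) (U : X.Opens) : Type u := localHoms M N U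

/-- Evaluation of a local morphism on the sections over `V ⊆ U`. -/
def LocalHom.ev {M N : X.Modules} {U : X.Opens} (φ : LocalHom M N U) {V : X.Opens} (h : V ≤ U) :
    Γ(M, V) →ₗ[Γ(X, V)] Γ(N, V) := φ.1 ⟨V, h⟩

theorem LocalHom.ext {M N : X.Modules} {U : X.Opens} {φ ψ : LocalHom M N U}
    (H : ∀ (V : X.Opens) (h : V ≤ U) (m : Γ(M, V)), LocalHom.ev φ h m = LocalHom.ev ψ h m) : φ = ψ :=
  Subtype.ext (funext fun V => LinearMap.ext fun m => H V.1 V.2 m)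

theorem LocalHom.res_ev {M N : X.Modules} {U : X.Opens} (φ : LocalHom M N U) {V W : X.Opens}
    (h : V ≤ U) (h' : W ≤ V) (m : Γ(M, V)) :
    res N h' (LocalHom.ev φ h m) = LocalHom.ev φ (h'.trans h) (res M h' m) :=
  φ.2 ⟨V, h⟩ ⟨W, h'.trans h⟩ h' m

/-- Restriction of local morphisms to a smaller open set. -/
def LocalHom.restrict {M N : X.Modules} {U U' : X.Opens} (h : U' ≤ U) :
    LocalHom M N U →+ LocalHom M N U' where
  toFun φ := ⟨fun V => LocalHom.ev φ (V.2.trans h), fun V _ h' m => LocalHom.res_ev φ (V.2.trans h) h' m⟩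
  map_zero' := rfl
  map_add' _ _ := rfl

@[simp]
theorem LocalHom.restrict_ev {M N : X.Modules} {U U' : X.Opens} (h : U' ≤ U) (φ : LocalHom M N U)
    {V : X.Opens} (h' : V ≤ U') : LocalHom.ev (LocalHom.restrict h φ) h' = LocalHom.ev φ (h'.trans h) := rfl

/-- The presheaf `U ↦ Hom(M|_U, N|_U)`. -/
def homPresheaf (M N : X.Modules) : TopCat.Presheaf AddCommGrpCat.{u} X where
  obj U := AddCommGrpCat.of (LocalHom M N U.unop)
  map i := AddCommGrpCat.ofHom (LocalHom.restrict (leOfHom i.unop))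
  map_id _ := rfl
  map_comp _ _ := by ext; rfl

theorem res_eq_of_locally_eq (N : X.Modules) {ι : Type*} (V : ι → X.Opens) {W : X.Opens}
    (hV : ∀ i, V i ≤ W) (hW : W ≤ iSup V) (s t : Γ(N, W))
    (h : ∀ i, res N (hV i) s = res N (hV i) t) : s = t :=
  TopCat.Sheaf.eq_of_locally_eq' ⟨N.presheaf, N.isSheaf⟩ V W (fun i => homOfLE (hV i)) hW s t h

theorem LocalHom.existsUnique_glue (M N : X.Modules) {ι : Type*} (U : ι → X.Opens)
    (sf : ∀ i, LocalHom M N (U i))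
    (hsf : ∀ (i j : ι) (V : X.Opens) (hi : V ≤ U i) (hj : V ≤ U j) (m : Γ(M, V)),
      LocalHom.ev (sf i) hi m = LocalHom.ev (sf j) hj m) :
    ∃! G : LocalHom M N (iSup U), ∀ i, LocalHom.restrict (le_iSup U i) G = sf i := by
  have cov : ∀ {V : X.Opens}, V ≤ iSup U → V ≤ ⨆ i, V ⊓ U i := fun {V} h => by
    rw [← inf_iSup_eq]; exact le_inf le_rfl h
  have key : ∀ (V : X.Opens) (hV : V ≤ iSup U) (m : Γ(M, V)), ∃ n : Γ(N, V),
      ∀ i, res N inf_le_left n = LocalHom.ev (sf i) inf_le_right (res M (inf_le_left : V ⊓ U i ≤ V) m) := by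
    intro V hV m
    obtain ⟨n, hn, -⟩ := TopCat.Sheaf.existsUnique_gluing' ⟨N.presheaf, N.isSheaf⟩
      (fun i => V ⊓ U i) V (fun i => homOfLE inf_le_left) (cov hV)
      (fun i => LocalHom.ev (sf i) inf_le_right (res M (inf_le_left : V ⊓ U i ≤ V) m)) (by
        intro i j
        change res N inf_le_left (LocalHom.ev (sf i) _ _) =
          res N inf_le_right (LocalHom.ev (sf j) _ _)
        rw [LocalHom.res_ev, LocalHom.res_ev, res_res, res_res]
        exact hsf i j _ _ _ _)
    exact ⟨n, hn⟩
  choose g hg using key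
  have uniq : ∀ (V : X.Opens) (hV : V ≤ iSup U) (m : Γ(M, V)) (n : Γ(N, V)),
      (∀ i, res N inf_le_left n =
        LocalHom.ev (sf i) inf_le_right (res M (inf_le_left : V ⊓ U i ≤ V) m)) → n = g V hV m :=
    fun V hV m n hn => res_eq_of_locally_eq N (fun i => V ⊓ U i) (fun i => inf_le_left) (cov hV) _ _
      fun i => (hn i).trans (hg V hV m i).symm
  let G : LocalHom M N (iSup U) :=
    ⟨fun V =>
      { toFun := g V.1 V.2
        map_add' := fun m m' => (uniq _ _ _ _ fun i => by
          rw [res_add, res_add, hg, hg, map_add]).symm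
        map_smul' := fun a m => (uniq _ _ _ _ fun i => by
          rw [RingHom.id_apply, res_smul, res_smul, hg, map_smul]).symm }, fun V W h m => by
      refine uniq W.1 W.2 (res M h m) (res N h (g V.1 V.2 m)) fun i => ?_
      have := congrArg (res N (inf_le_inf_right (U i) h : W.1 ⊓ U i ≤ V.1 ⊓ U i)) (hg V.1 V.2 m i)
      rw [LocalHom.res_ev, res_res, res_res] at this
      rw [res_res, res_res]
      exact this⟩
  have hG : ∀ (i : ι) (V : X.Opens) (h : V ≤ U i) (m : Γ(M, V)),
      g V (h.trans (le_iSup U i)) m = LocalHom.ev (sf i) h m := fun i V h m =>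
    (uniq _ _ _ _ fun j => by
      rw [LocalHom.res_ev]; exact hsf i j _ _ _ _).symm
  refine ⟨G, fun i => LocalHom.ext fun V h m => hG i V h m, fun G' hG' => ?_⟩
  refine LocalHom.ext fun V h m => uniq V h m _ fun i => ?_
  rw [LocalHom.res_ev]
  exact congr(LocalHom.ev $(hG' i) inf_le_right (res M inf_le_left m))

theorem homPresheaf_isSheaf (M N : X.Modules) : (homPresheaf M N).IsSheaf := by
  rw [TopCat.Presheaf.isSheaf_iff_isSheafUniqueGluing]
  intro ι U sf hsf
  exact LocalHom.existsUnique_glue M N U sf fun i j V hi hj m =>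
    congr(LocalHom.ev (M := M) (N := N) (U := U i ⊓ U j) $(hsf i j) (le_inf hi hj) m)

/-- The sheaf `ℋom(M, N)`, as a sheaf of abelian groups. -/
def homSheaf (M N : X.Modules) : Sheaf (Opens.grothendieckTopology X) AddCommGrpCat.{u} :=
  ⟨homPresheaf M N, homPresheaf_isSheaf M N⟩

end LocalHom
section Sequences

variable (X : Scheme.{u}) {K : Type u} [Field K] [X.Over (Spec (CommRingCat.of K))]
variable (δ : Derivation ℤ K K)

/-- `Ω_X`, the sheaf of absolute differentials: the sheaf associated to `U ↦ Ω_{𝒪(U)}`. -/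
def omegaAbs : X.Modules := sheafify.obj (absPresheaf X)

variable (K) in
/-- `Ω_{X/K}`, the sheaf of relative differentials: the sheaf associated to `U ↦ Ω_{𝒪(U)/K}`. -/
def omegaRel : X.Modules := sheafify.obj (relPresheaf X K)

variable (K) in
/-- `f^* Ω_K`, the pullback of `Ω_K` along the structure morphism `f : X ⟶ Spec K`: the sheaf
associated to `U ↦ 𝒪(U) ⊗_K Ω_K`. -/
def omegaBase : X.Modules := sheafify.obj (basePresheaf X K)

/-- `Ω^τ_X`, the sheaf of `τ`-differentials: the sheaf associated to `U ↦ Ω^τ_{𝒪(U)/K}`. As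
`τ`-differentials commute with localization, it is the quasi-coherent sheaf with value `Ω^τ_{R/K}`
on an affine open `Spec R`. -/
def omegaTau : X.Modules := sheafify.obj (tauPresheaf X δ)

variable (K) in
/-- `α : f^* Ω_K ⟶ Ω_X`. -/
def baseToAbsHom : omegaBase X K ⟶ omegaAbs X := sheafify.map (baseToAbsPresheaf X K)

variable (K) in
/-- `β : Ω_X ⟶ Ω_{X/K}`. -/
def absToRelHom : omegaAbs X ⟶ omegaRel X K := sheafify.map (absToRelPresheaf X K)

/-- `Λ : Ω^τ_X ⟶ Ω_{X/K}`, `τr ↦ dr`. -/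
def tauToRelHom : omegaTau X δ ⟶ omegaRel X K := sheafify.map (tauToRelPresheaf X δ)

/-- `ι : 𝒪_X ⟶ Ω^τ_X`, `r ↦ r τe`. -/
def unitToTauHom (e : K) : structureSheaf X ⟶ omegaTau X δ :=
  (Scheme.Modules.toPresheafOfModules X).preimage
    (unitToTauPresheaf X δ e ≫ toSheafify (tauPresheaf X δ))

/-- `f^* Ω_K ⟶ 𝒪_X`, `r ⊗ da ↦ r δ(a)`. -/
def contractHom : omegaBase X K ⟶ structureSheaf X := sheafifyDesc (contractPresheaf X δ)

theorem unitToTauHom_comp (e : K) : unitToTauHom X δ e ≫ tauToRelHom X δ = 0 := by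
  have h : unitToTauPresheaf X δ e ≫ tauToRelPresheaf X δ = 0 := by
    refine PresheafOfModules.hom_ext fun U => ModuleCat.hom_ext (LinearMap.ext fun r => ?_)
    exact tauToRel_unitToTau δ e (R := Γ(X, U.unop)) r
  apply (Scheme.Modules.toPresheafOfModules X).map_injective
  rw [toPresheaf_map_zero]
  refine ((Scheme.Modules.toPresheafOfModules X).map_comp _ _).trans ?_
  rw [unitToTauHom, Functor.map_preimage]
  refine (Category.assoc _ _ _).trans ?_
  refine (congrArg (unitToTauPresheaf X δ e ≫ ·)
    (sheafifyAdj.unit.naturality (tauToRelPresheaf X δ)).symm).trans ?_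
  refine (Category.assoc _ _ _).symm.trans ?_
  refine (congrArg (· ≫ _) h).trans ?_
  exact Limits.zero_comp

variable (K) in
theorem baseToAbsHom_comp : baseToAbsHom X K ≫ absToRelHom X K = 0 := by
  have h : baseToAbsPresheaf X K ≫ absToRelPresheaf X K = 0 := by
    refine PresheafOfModules.hom_ext fun U => ModuleCat.hom_ext (LinearMap.ext fun r => ?_)
    exact absToRel_baseToAbs (K := K) (R := Γ(X, U.unop)) r
  refine (sheafify.map_comp _ _).symm.trans ?_
  exact (congrArg sheafify.map h).trans (sheafify_map_zero _ _)

/-- `0 ⟶ 𝒪_X ⟶ Ω^τ_X ⟶ Ω_{X/K} ⟶ 0`. -/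
abbrev tauSequence (e : K) : ShortComplex X.Modules :=
  ShortComplex.mk (unitToTauHom X δ e) (tauToRelHom X δ) (unitToTauHom_comp X δ e)

variable (K) in
/-- `0 ⟶ f^* Ω_K ⟶ Ω_X ⟶ Ω_{X/K} ⟶ 0`. -/
abbrev cotangentSequence : ShortComplex X.Modules :=
  ShortComplex.mk (baseToAbsHom X K) (absToRelHom X K) (baseToAbsHom_comp X K)

variable {X}

variable (K) in
/-- The universal derivation `d : 𝒪_X(U) ⟶ Ω_{X/K}(U)`. -/
def universalD (U : X.Opens) (a : Γ(X, U)) : Γ(omegaRel X K, U) :=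
  (toSheafify (relPresheaf X K)).app (op U)
    (KaehlerDifferential.D K Γ(X, U) a : Ω[Γ(X, U)⁄K])

end Sequences

section Classes

variable {X : Scheme.{u}}

/-- `Ext` groups of `𝒪_X`-modules exist (in a large universe). -/
instance hasExtModules (X : Scheme.{u}) : HasExt.{u + 1} X.Modules := HasExt.standard _

/-- The constant sheaf `ℤ_X`. -/
abbrev constInt (X : Scheme.{u}) : Sheaf (Opens.grothendieckTopology X) AddCommGrpCat.{u} :=
  (constantSheaf (Opens.grothendieckTopology X) AddCommGrpCat.{u}).obj
    (AddCommGrpCat.of (ULift.{u} ℤ))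

/-- The section `1` of the constant sheaf `ℤ_X` over `U`. -/
def constOne (U : X.Opens) : (constInt X).obj.obj (op U) :=
  (CategoryTheory.toSheafify (Opens.grothendieckTopology X)
    ((Functor.const _).obj (AddCommGrpCat.of (ULift.{u} ℤ)))).app (op U) (ULift.up (1 : ℤ))

/-- The class `h ∈ H¹(X, F) = Ext¹(ℤ_X, F)` is represented by the Čech cocycle `c` over the open
cover `U`: it is the class of an extension `0 ⟶ F ⟶ G ⟶ ℤ_X ⟶ 0` in which the section `1` has
local lifts `t i ∈ G(U i)` with `t j - t i = c i j` on `U i ∩ U j`. -/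
def IsRepresentedBy (F : Sheaf (Opens.grothendieckTopology X) AddCommGrpCat.{u})
    (h : Sheaf.H F 1) {ι : Type u} (U : ι → X.Opens)
    (c : ∀ i j, F.obj.obj (op (U i ⊓ U j))) : Prop :=
  iSup U = ⊤ ∧
  ∃ (G : Sheaf (Opens.grothendieckTopology X) AddCommGrpCat.{u}) (f : F ⟶ G) (g : G ⟶ constInt X)
    (w : f ≫ g = 0) (hS : (ShortComplex.mk f g w).ShortExact) (t : ∀ i, G.obj.obj (op (U i))),
    (∀ i, g.hom.app _ (t i) = constOne (U i)) ∧
    (∀ i j, f.hom.app _ (c i j) =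
      G.obj.map (homOfLE inf_le_right).op (t j) - G.obj.map (homOfLE inf_le_left).op (t i)) ∧
    hS.extClass = h

/-- `Φ` is the canonical isomorphism `Ext¹(M, N) ≅ H¹(X, ℋom(M, N))`: it sends the class of an
extension `0 ⟶ N ⟶ E ⟶ M ⟶ 0` with local splittings `s k : M|_{U k} ⟶ E|_{U k}` over an open
cover to the class of the cocycle `s l - s k`, with values in `ℋom(M, N)`. -/
def IsCanonicalIso (M N : X.Modules) (Φ : Abelian.Ext M N 1 ≃+ Sheaf.H (homSheaf M N) 1) : Prop :=
  ∀ (E : X.Modules) (i : N ⟶ E) (p : E ⟶ M) (w : i ≫ p = 0)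
    (hS : (ShortComplex.mk i p w).ShortExact) (ι : Type u) (U : ι → X.Opens) (_ : iSup U = ⊤)
    (s : ∀ k, LocalHom M E (U k)) (c : ∀ k l, LocalHom M N (U k ⊓ U l)),
    (∀ (k : ι) (V : X.Opens) (h : V ≤ U k) (m : Γ(M, V)), p.app V (LocalHom.ev (s k) h m) = m) →
    (∀ (k l : ι) (V : X.Opens) (h : V ≤ U k ⊓ U l) (m : Γ(M, V)),
      i.app V (LocalHom.ev (c k l) h m) =
        LocalHom.ev (s l) (h.trans inf_le_right) m - LocalHom.ev (s k) (h.trans inf_le_left) m) →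
    IsRepresentedBy (homSheaf M N) (Φ hS.extClass) U c

variable {K : Type u} [Field K] [X.Over (Spec (CommRingCat.of K))] (δ : Derivation ℤ K K)

/-- A lift of `δ` to a derivation of the sheaf `𝒪_X|_U`: compatible derivations of the rings
`𝒪(V)`, for `V ⊆ U` open, that extend the derivation `δ` of `K`. -/
structure LocalLift (U : X.Opens) where
  /-- the derivation of `𝒪(V)` -/
  D : ∀ {V : X.Opens}, V ≤ U → Derivation ℤ Γ(X, V) Γ(X, V)
  D_res : ∀ {V W : X.Opens} (h : V ≤ U) (h' : W ≤ V) (a : Γ(X, V)),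
    X.presheaf.map (homOfLE h').op (D h a) = D (h'.trans h) (X.presheaf.map (homOfLE h').op a)
  D_algebraMap : ∀ {V : X.Opens} (h : V ≤ U) (a : K),
    D h (algebraMap K Γ(X, V) a) = algebraMap K Γ(X, V) (δ a)

/-- The Kodaira–Spencer class as an element of `Ext¹(Ω_{X/K}, 𝒪_X)`: the image of
`r ⊗ da ↦ r δ(a)` under the connecting map `Hom(f^* Ω_K, 𝒪_X) → Ext¹(Ω_{X/K}, 𝒪_X)` of the
exact sequence `0 ⟶ f^* Ω_K ⟶ Ω_X ⟶ Ω_{X/K} ⟶ 0`. -/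
def kodairaSpencerExt (hΩ : (cotangentSequence X K).ShortExact) :
    Abelian.Ext (omegaRel X K) (structureSheaf X) 1 :=
  hΩ.extClass.comp (Abelian.Ext.mk₀ (contractHom X δ)) (add_zero 1)

variable (X K) in
/-- `Θ_{X/K} = ℋom(Ω_{X/K}, 𝒪_X)`, the dual of the sheaf of relative differentials. -/
def tangentSheaf : Sheaf (Opens.grothendieckTopology X) AddCommGrpCat.{u} :=
  homSheaf (omegaRel X K) (structureSheaf X)

/-- The class `h ∈ H¹(X, Θ_{X/K})` is the Kodaira–Spencer class of `X` (with respect to `δ`): it is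
represented by the cocycle `D i - D j`, where the `D i` are lifts of `δ` to derivations of
`𝒪_X|_{U i}` for some open cover of `X`. The difference `D i - D j` is a `K`-linear derivation of
`𝒪_X|_{U i ∩ U j}`, and `c i j` is the corresponding local section of `Θ_{X/K}`. -/
def IsKodairaSpencerClass (h : Sheaf.H (tangentSheaf X K) 1) : Prop :=
  ∃ (ι : Type u) (U : ι → X.Opens) (D : ∀ i, LocalLift δ (U i))
    (c : ∀ i j, LocalHom (omegaRel X K) (structureSheaf X) (U i ⊓ U j)),
    (∀ (i j : ι) (V : X.Opens) (hV : V ≤ U i ⊓ U j) (a : Γ(X, V)),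
      LocalHom.ev (c i j) hV (universalD K V a) =
        ((D i).D (hV.trans inf_le_left) a - (D j).D (hV.trans inf_le_right) a : Γ(X, V))) ∧
    IsRepresentedBy (tangentSheaf X K) h U c

end Classes

end

end TauKS

open TauKS

/-! Exactness is local. On an affine open with ring `R`, formal smoothness over `K` makes
`H1Cotangent` vanish and `Ω_{R/K}` projective, so `0 → R ⊗ Ω_K → Ω_R → Ω_{R/K} → 0` is split exact.
Since `δ e = 1`, the relation `δ(a) τe = δ(e) τa` reads `τa = δ(a) τe`: the map `da ↦ τa` carries `R
⊗ Ω_K` into `R τe` through the contraction `r ⊗ da ↦ r δ(a)` (`tauProj_baseToAbs`). This gives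
exactness in the middle of the `τ`-sequence, and an extension of the contraction to `Ω_R`, which
exists by the splitting, descends to a retraction of `r ↦ r τe`. The triple (contraction, `da ↦ τa`,
identity) is a morphism from the second sequence to the first, so naturality of extension classes
yields the equality with the Kodaira–Spencer class in `Ext¹`.

For `Φ`, put `M = Ω_{X/K}`, which is locally free of finite rank (`isLocallyFree_omegaRel`), so
`ℋom(M, -)` is exact. Apply it to an extension of `M` by `N` and pull back along `1 : ℤ_X ⟶ ℋom(M,
M)`. For `0 → N → I → Q → 0` with `I` injective, both `Ext¹(M, N)` and `H¹(X, ℋom(M, N))` are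
`Hom(M, Q)` modulo `Hom(M, I)`, because `ℋom(M, I)` is flasque (`homSheaf_isFlasque`) and so has no
`H¹`. The Čech description holds because local splittings are exactly the local lifts of the section
`1` in the pulled-back extension. It determines `Φ`: every extension of `M` splits locally, and a
cocycle represents at most one class (`IsRepresentedBy.unique`).

For Buium's class, the formula `s(da) = τa - D(a) τe` matches local splittings `s` of the
`τ`-sequence with local lifts `D` of `δ`. Under it `s_j - s_i` becomes `(D_i - D_j) τe`, so the two
cocycles coincide. -/

namespace TauKS

noncomputable section

/-! ### Enough injectives in the category of sheaves of modules -/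

section Grothendieck

open Limits

/-- Such colimits can be tested on the underlying presheaves of abelian groups: the forgetful
functor preserves finite limits and these colimits, and it reflects isomorphisms. -/
theorem presheafOfModules_hasExactColimitsOfShape {C : Type u} [SmallCategory C]
    (R : Cᵒᵖ ⥤ RingCat.{u}) (J : Type u) [SmallCategory J] [IsFiltered J] :
    HasExactColimitsOfShape J (PresheafOfModules.{u} R) := by
  have : PreservesFiniteLimits (PresheafOfModules.toPresheaf R) := inferInstance
  have : PreservesColimitsOfShape J (PresheafOfModules.toPresheaf R) := inferInstance
  have : HasExactColimitsOfShape J (Cᵒᵖ ⥤ AddCommGrpCat.{u}) := inferInstance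
  have : ReflectsFiniteLimits (PresheafOfModules.toPresheaf R) :=
    ⟨fun _ _ _ => reflectsLimitsOfShape_of_reflectsIsomorphisms⟩
  exact HasExactColimitsOfShape.domain_of_functor J (PresheafOfModules.toPresheaf R)

/-- The sheafified free modules on representables separate, because by adjunction maps out of them
are maps out of the free presheaves, which separate presheaves. Their coproduct is a single
separator. -/
theorem sheafOfModules_hasSeparator {C : Type u} [SmallCategory C] {J : GrothendieckTopology C}
    (R : Sheaf J RingCat.{u}) : HasSeparator (SheafOfModules.{u} R) := by
  let adj := PresheafOfModules.sheafificationAdjunction (𝟙 R.obj)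
  let S : C → SheafOfModules.{u} R := fun X =>
    (PresheafOfModules.sheafification (𝟙 R.obj)).obj
      ((PresheafOfModules.free R.obj).obj (yoneda.obj X))
  have hS : ObjectProperty.IsSeparating (.ofObj S) := by
    intro F G f g hfg
    refine (SheafOfModules.forget R).map_injective
      (PresheafOfModules.freeYoneda.isSeparating R.obj _ _ ?_)
    rintro _ ⟨X⟩ a
    obtain ⟨b, rfl⟩ := (adj.homEquiv ((PresheafOfModules.free R.obj).obj (yoneda.obj X)) F).surjective a
    have h := congrArg (adj.homEquiv _ _) (hfg _ (ObjectProperty.ofObj_apply S X) b)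
    rw [adj.homEquiv_naturality_right, adj.homEquiv_naturality_right] at h
    exact h
  exact ⟨_, hS.isSeparator_coproduct⟩

theorem modules_isGrothendieckAbelian (X : Scheme.{u}) :
    IsGrothendieckAbelian.{u} X.Modules := by
  let adj := PresheafOfModules.sheafificationAdjunction (𝟙 X.ringCatSheaf.obj)
  have : HasSeparator (SheafOfModules.{u} X.ringCatSheaf) := sheafOfModules_hasSeparator _
  have : AB5OfSize.{u, u} (SheafOfModules.{u} X.ringCatSheaf) := ⟨fun J _ _ => by
    have := presheafOfModules_hasExactColimitsOfShape X.ringCatSheaf.obj J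
    exact adj.hasExactColimitsOfShape J⟩
  have : IsGrothendieckAbelian.{u} (SheafOfModules.{u} X.ringCatSheaf) := {}
  exact this

instance modules_enoughInjectives (X : Scheme.{u}) : EnoughInjectives X.Modules :=
  have := modules_isGrothendieckAbelian X
  inferInstance

end Grothendieck

/-! ### Abelian sheaves: exactness in terms of sections -/

section AbSheaf

open Limits

variable {X : TopCat.{u}}

/-- Sheaves of abelian groups on a topological space. -/
abbrev AbSheaf (X : TopCat.{u}) := Sheaf (Opens.grothendieckTopology X) AddCommGrpCat.{u}

/-- Restriction of sections of a sheaf of abelian groups. -/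
def abRes (F : AbSheaf X) {U V : Opens X} (h : V ≤ U) (a : F.obj.obj (op U)) : F.obj.obj (op V) :=
  F.obj.map (homOfLE h).op a

theorem abRes_abRes (F : AbSheaf X) {U V W : Opens X} (h : V ≤ U) (h' : W ≤ V)
    (a : F.obj.obj (op U)) : abRes F h' (abRes F h a) = abRes F (h'.trans h) a :=
  congr($(F.obj.map_comp (homOfLE h).op (homOfLE h').op) a).symm

theorem abRes_self (F : AbSheaf X) {U : Opens X} (a : F.obj.obj (op U)) :
    abRes F le_rfl a = a := congr($(F.obj.map_id (op U)) a)

theorem abRes_sub (F : AbSheaf X) {U V : Opens X} (h : V ≤ U) (a b : F.obj.obj (op U)) :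
    abRes F h (a - b) = abRes F h a - abRes F h b := map_sub _ _ _

theorem abRes_app {F G : AbSheaf X} (f : F ⟶ G) {U V : Opens X} (h : V ≤ U)
    (a : F.obj.obj (op U)) : f.hom.app (op V) (abRes F h a) = abRes G h (f.hom.app (op U) a) :=
  congr($(f.hom.naturality (homOfLE h).op) a)

theorem app_app_eq_zero {F G H : AbSheaf X} {f : F ⟶ G} {g : G ⟶ H} (w : f ≫ g = 0)
    {U : Opens X} (a : F.obj.obj (op U)) : g.hom.app (op U) (f.hom.app (op U) a) = 0 :=
  congr($(w).hom.app (op U) a)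

theorem abSheaf_eq_of_locally_eq (F : AbSheaf X) {U : Opens X} {a b : F.obj.obj (op U)}
    (h : ∀ x ∈ U, ∃ (V : Opens X) (hV : V ≤ U), x ∈ V ∧ abRes F hV a = abRes F hV b) : a = b := by
  choose V hV hx hab using h
  refine TopCat.Sheaf.eq_of_locally_eq' ⟨F.obj, F.property⟩ (fun x : U => V x.1 x.2) U
    (fun x => homOfLE (hV x.1 x.2)) (fun x hx' => ?_) a b fun x => hab x.1 x.2
  exact Opens.mem_iSup.2 ⟨⟨x, hx'⟩, hx x hx'⟩

theorem abSheaf_existsUnique_glue (F : AbSheaf X) {ι : Type u} (U : ι → Opens X)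
    (a : ∀ i, F.obj.obj (op (U i)))
    (h : ∀ i j, abRes F (inf_le_left : U i ⊓ U j ≤ U i) (a i) = abRes F inf_le_right (a j)) :
    ∃! b : F.obj.obj (op (iSup U)), ∀ i, abRes F (le_iSup U i) b = a i :=
  TopCat.Sheaf.existsUnique_gluing ⟨F.obj, F.property⟩ U a h

theorem abSheaf_exists_glue (F : AbSheaf X) {ι : Type u} (U : ι → Opens X) {W : Opens X}
    (hW : iSup U = W) (a : ∀ i, F.obj.obj (op (U i)))
    (h : ∀ i j, abRes F (inf_le_left : U i ⊓ U j ≤ U i) (a i) = abRes F inf_le_right (a j)) :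
    ∃ b : F.obj.obj (op W), ∀ i, abRes F (hW ▸ le_iSup U i) b = a i := by
  subst hW
  exact (abSheaf_existsUnique_glue F U a h).exists

theorem abSheaf_mono_iff {F G : AbSheaf X} (f : F ⟶ G) :
    Mono f ↔ ∀ U, Function.Injective (f.hom.app (op U)) := by
  constructor
  · intro _ U
    have : Mono ((sheafToPresheaf _ _ ⋙ (evaluation _ _).obj (op U)).map f) := inferInstance
    exact (AddCommGrpCat.mono_iff_injective _).1 this
  · intro h
    refine ⟨fun {H} a b hab => ?_⟩
    refine Sheaf.hom_ext (NatTrans.ext (funext fun U => AddCommGrpCat.hom_ext (AddMonoidHom.ext fun x => ?_)))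
    exact h U.unop congr($(hab).hom.app U x)

theorem abSheaf_locally_lift {F G : AbSheaf X} (f : F ⟶ G) [hf : Epi f] {U : Opens X}
    (b : G.obj.obj (op U)) {x : X} (hx : x ∈ U) :
    ∃ (V : Opens X) (hV : V ≤ U), x ∈ V ∧ ∃ a, f.hom.app (op V) a = abRes G hV b := by
  obtain ⟨V, hV, ⟨a, ha⟩, hxV⟩ := (TopCat.Presheaf.isLocallySurjective_iff f.hom).1
    ((TopCat.Sheaf.isLocallySurjective_iff_epi f).2 hf) U b x hx
  exact ⟨V, hV, hxV, a, ha⟩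

theorem abSheaf_epi_of_locally_lift {F G : AbSheaf X} (f : F ⟶ G)
    (h : ∀ (U : Opens X) (b : G.obj.obj (op U)), ∀ x ∈ U,
      ∃ (V : Opens X) (hV : V ≤ U), x ∈ V ∧ ∃ a, f.hom.app (op V) a = abRes G hV b) : Epi f :=
  (TopCat.Sheaf.isLocallySurjective_iff_epi f).1
    ((TopCat.Presheaf.isLocallySurjective_iff f.hom).2 fun U b x hx =>
      let ⟨V, hV, hxV, a, ha⟩ := h U b x hx
      ⟨V, hV, ⟨a, ha⟩, hxV⟩)

theorem abSheaf_shortExact_sections {S : ShortComplex (AbSheaf X)} (hS : S.ShortExact)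
    {U : Opens X} (b : S.X₂.obj.obj (op U)) (hb : S.g.hom.app (op U) b = 0) :
    ∃ a, S.f.hom.app (op U) a = b :=
  TopCat.Sheaf.sections_exact_of_left_exact hS.1 hS.2 b hb

/-- Exactness in the middle means that the map to the kernel sheaf is locally surjective. As the
kernel inclusion is injective on sections, this can be checked inside `S.X₂`. -/
theorem abSheaf_shortExact_of_sections {S : ShortComplex (AbSheaf X)}
    (hf : ∀ U, Function.Injective (S.f.hom.app (op U)))
    (hfg : ∀ (U : Opens X) (b : S.X₂.obj.obj (op U)), S.g.hom.app (op U) b = 0 → ∀ x ∈ U,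
      ∃ (V : Opens X) (hV : V ≤ U), x ∈ V ∧ ∃ a, S.f.hom.app (op V) a = abRes S.X₂ hV b)
    (hg : ∀ (U : Opens X) (b : S.X₃.obj.obj (op U)), ∀ x ∈ U,
      ∃ (V : Opens X) (hV : V ≤ U), x ∈ V ∧ ∃ a, S.g.hom.app (op V) a = abRes S.X₃ hV b) :
    S.ShortExact where
  mono_f := (abSheaf_mono_iff _).2 hf
  epi_g := abSheaf_epi_of_locally_lift _ hg
  exact := by
    rw [ShortComplex.exact_iff_epi_kernel_lift]
    refine abSheaf_epi_of_locally_lift _ fun U b x hx => ?_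
    obtain ⟨V, hV, hxV, a, ha⟩ := hfg U ((kernel.ι S.g).hom.app (op U) b)
      (app_app_eq_zero (kernel.condition S.g) b) x hx
    refine ⟨V, hV, hxV, a, (abSheaf_mono_iff (kernel.ι S.g)).1 inferInstance V ?_⟩
    rw [abRes_app, ← ha]
    exact congr($(kernel.lift_ι S.g S.f S.zero).hom.app (op V) a)

end AbSheaf

/-! ### Colimits in a reflective subcategory -/

section Reflective

open Limits

/-- Every diagram `K` in `D` is isomorphic to `K ⋙ G ⋙ F` through the counit, and the colimit of the
latter is the reflection of a colimit in `C`. -/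
theorem preservesColimitsOfShape_of_comp_reflector {C D E J : Type*} [Category C] [Category D]
    [Category E] [Category J] {F : C ⥤ D} {G : D ⥤ C} (adj : F ⊣ G) [G.Full] [G.Faithful]
    (H : D ⥤ E) [HasColimitsOfShape J C] [PreservesColimitsOfShape J (F ⋙ H)] :
    PreservesColimitsOfShape J H where
  preservesColimit {K} := by
    have := adj.leftAdjoint_preservesColimits
    have hc := colimit.isColimit (K ⋙ G)
    have : PreservesColimit ((K ⋙ G) ⋙ F) H :=
      preservesColimit_of_preserves_colimit_cocone (isColimitOfPreserves F hc)
        (isColimitOfPreserves (F ⋙ H) hc)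
    exact preservesColimit_of_iso_diagram H
      (Functor.associator _ _ _ ≪≫ Functor.isoWhiskerLeft K (asIso adj.counit) ≪≫
        K.rightUnitor)

end Reflective

/-! ### The exact faithful functor from modules to abelian sheaves -/

section ModulesToAb

open Limits

variable (X : Scheme.{u})

/-- The underlying sheaf of abelian groups of a sheaf of modules. -/
def toAbSheaf : X.Modules ⥤ AbSheaf X.carrier := SheafOfModules.toSheaf X.ringCatSheaf

instance : (toAbSheaf X).Additive :=
  inferInstanceAs (SheafOfModules.toSheaf X.ringCatSheaf).Additive

instance : (toAbSheaf X).Faithful :=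
  inferInstanceAs (SheafOfModules.toSheaf X.ringCatSheaf).Faithful

instance : PreservesFiniteLimits (toAbSheaf X) where
  preservesFiniteLimits J _ _ := by
    have : PreservesLimitsOfShape J (toAbSheaf X ⋙ sheafToPresheaf _ _) :=
      inferInstanceAs (PreservesLimitsOfShape J
        (SheafOfModules.forget X.ringCatSheaf ⋙ PresheafOfModules.toPresheaf _))
    exact preservesLimitsOfShape_of_reflects_of_preserves (toAbSheaf X) (sheafToPresheaf _ _)

instance : PreservesFiniteColimits (toAbSheaf X) where
  preservesFiniteColimits J _ _ := by
    have : PreservesColimitsOfShape J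
        (PresheafOfModules.sheafification (𝟙 X.ringCatSheaf.obj) ⋙
          SheafOfModules.toSheaf X.ringCatSheaf) :=
      inferInstanceAs (PreservesColimitsOfShape J
        (PresheafOfModules.toPresheaf X.ringCatSheaf.obj ⋙ presheafToSheaf _ _))
    exact preservesColimitsOfShape_of_comp_reflector
      (PresheafOfModules.sheafificationAdjunction (𝟙 X.ringCatSheaf.obj))
      (SheafOfModules.toSheaf X.ringCatSheaf)

variable {X}

/-- The forgetful functor is exact and faithful, so short exactness of modules may be tested on
abelian sheaves, and hence on sections. -/
theorem shortExact_toAbSheaf_iff {S : ShortComplex X.Modules} :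
    (S.map (toAbSheaf X)).ShortExact ↔ S.ShortExact :=
  ShortExact.shortExact_map_iff (toAbSheaf X)

theorem res_app {M N : X.Modules} (f : M ⟶ N) {U V : X.Opens} (h : V ≤ U) (m : Γ(M, U)) :
    f.app V (res M h m) = res N h (f.app U m) :=
  abRes_app ((toAbSheaf X).map f) h m

theorem modules_eq_of_locally_eq (M : X.Modules) {U : X.Opens} {a b : Γ(M, U)}
    (h : ∀ x ∈ U, ∃ (V : X.Opens) (hV : V ≤ U), x ∈ V ∧ res M hV a = res M hV b) : a = b :=
  abSheaf_eq_of_locally_eq ((toAbSheaf X).obj M) h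

theorem modules_app_injective {M N : X.Modules} (f : M ⟶ N) [Mono f] (U : X.Opens) :
    Function.Injective (f.app U) :=
  (abSheaf_mono_iff ((toAbSheaf X).map f)).1 inferInstance U

theorem modules_mono_of_app_injective {M N : X.Modules} (f : M ⟶ N)
    (h : ∀ U, Function.Injective (f.app U)) : Mono f :=
  (toAbSheaf X).mono_of_mono_map ((abSheaf_mono_iff ((toAbSheaf X).map f)).2 h)

theorem modules_locally_lift {M N : X.Modules} (f : M ⟶ N) [Epi f] {U : X.Opens}
    (b : Γ(N, U)) {x : X} (hx : x ∈ U) :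
    ∃ (V : X.Opens) (hV : V ≤ U), x ∈ V ∧ ∃ a, f.app V a = res N hV b :=
  abSheaf_locally_lift ((toAbSheaf X).map f) b hx

theorem modules_shortExact_sections {S : ShortComplex X.Modules} (hS : S.ShortExact)
    {U : X.Opens} (b : Γ(S.X₂, U)) (hb : S.g.app U b = 0) : ∃ a, S.f.app U a = b :=
  abSheaf_shortExact_sections (shortExact_toAbSheaf_iff.2 hS) b hb

theorem modules_shortExact_of_sections {S : ShortComplex X.Modules}
    (hf : ∀ U, Function.Injective (S.f.app U))
    (hfg : ∀ (U : X.Opens) (b : Γ(S.X₂, U)), S.g.app U b = 0 → ∀ x ∈ U,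
      ∃ (V : X.Opens) (hV : V ≤ U), x ∈ V ∧ ∃ a, S.f.app V a = res S.X₂ hV b)
    (hg : ∀ (U : X.Opens) (b : Γ(S.X₃, U)), ∀ x ∈ U,
      ∃ (V : X.Opens) (hV : V ≤ U), x ∈ V ∧ ∃ a, S.g.app V a = res S.X₃ hV b) :
    S.ShortExact :=
  shortExact_toAbSheaf_iff.1 (abSheaf_shortExact_of_sections hf hfg hg)

end ModulesToAb

/-! ### The functor `ℋom(M, -)` -/

section HomFunctor

open Limits

variable {X : Scheme.{u}} {M N E Q : X.Modules}

/-- The linear map on sections induced by a morphism of sheaves of modules. -/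
def appLinear (f : M ⟶ N) (V : X.Opens) : Γ(M, V) →ₗ[Γ(X, V)] Γ(N, V) where
  toFun := f.app V
  map_add' := map_add _
  map_smul' r m := Scheme.Modules.Hom.app_smul f r m

/-- Composition of a local morphism with a morphism of sheaves of modules. -/
def LocalHom.postcomp (f : N ⟶ E) (U : X.Opens) : LocalHom M N U →+ LocalHom M E U where
  toFun φ := ⟨fun V => appLinear f V.1 ∘ₗ LocalHom.ev φ V.2, fun V W h m => by
    change res E h (f.app V.1 (LocalHom.ev φ V.2 m)) = f.app W.1 (LocalHom.ev φ W.2 _)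
    rw [← res_app, LocalHom.res_ev]⟩
  map_zero' := LocalHom.ext fun V h m => map_zero (appLinear f V)
  map_add' φ ψ := LocalHom.ext fun V h m =>
    map_add (appLinear f V) (LocalHom.ev φ h m) (LocalHom.ev ψ h m)

theorem LocalHom.postcomp_ev (f : N ⟶ E) {U V : X.Opens} (φ : LocalHom M N U) (h : V ≤ U)
    (m : Γ(M, V)) : LocalHom.ev (LocalHom.postcomp f U φ) h m = f.app V (LocalHom.ev φ h m) := rfl

theorem LocalHom.add_ev {U V : X.Opens} (φ ψ : LocalHom M N U) (h : V ≤ U)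
    (m : Γ(M, V)) : LocalHom.ev (φ + ψ) h m = LocalHom.ev φ h m + LocalHom.ev ψ h m := rfl

theorem LocalHom.sub_ev {U V : X.Opens} (φ ψ : LocalHom M N U) (h : V ≤ U)
    (m : Γ(M, V)) : LocalHom.ev (φ - ψ) h m = LocalHom.ev φ h m - LocalHom.ev ψ h m := by
  rw [eq_sub_iff_add_eq, ← LocalHom.add_ev, sub_add_cancel]

/-- The functor `ℋom(M, -)` from sheaves of modules to sheaves of abelian groups. -/
def homFunctor (M : X.Modules) : X.Modules ⥤ AbSheaf X.carrier where
  obj N := homSheaf M N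
  map f := ⟨{ app := fun U => AddCommGrpCat.ofHom (LocalHom.postcomp f U.unop)
              naturality := fun _ _ _ => rfl }⟩
  map_id _ := rfl
  map_comp _ _ := rfl

instance (M : X.Modules) : (homFunctor M).Additive where
  map_add := rfl

/-- The restriction of a morphism of sheaves of modules to an open subset. -/
def LocalHom.ofHom (f : M ⟶ N) (U : X.Opens) : LocalHom M N U :=
  ⟨fun V => appLinear f V.1, fun _ _ h m => (res_app f h m).symm⟩

/-- A local morphism over the whole scheme is a morphism. -/
def LocalHom.toHom (φ : LocalHom M N ⊤) : M ⟶ N :=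
  (Scheme.Modules.toPresheafOfModules X).preimage
    { app := fun U => (ModuleCat.ofHom (LocalHom.ev φ (le_top : U.unop ≤ ⊤)) :
        ModuleCat.of Γ(X, U.unop) Γ(M, U.unop) ⟶ ModuleCat.of Γ(X, U.unop) Γ(N, U.unop))
      naturality := fun i => ModuleCat.hom_ext (LinearMap.ext fun m =>
        (LocalHom.res_ev φ le_top (leOfHom i.unop) m).symm) }

theorem LocalHom.toHom_app (φ : LocalHom M N ⊤) (U : X.Opens) (m : Γ(M, U)) :
    (LocalHom.toHom φ).app U m = LocalHom.ev φ le_top m := by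
  have := (Scheme.Modules.toPresheafOfModules X).map_preimage
    ({ app := fun U => (ModuleCat.ofHom (LocalHom.ev φ (le_top : U.unop ≤ ⊤)) :
        ModuleCat.of Γ(X, U.unop) Γ(M, U.unop) ⟶ ModuleCat.of Γ(X, U.unop) Γ(N, U.unop))
       naturality := fun i => ModuleCat.hom_ext (LinearMap.ext fun m =>
        (LocalHom.res_ev φ le_top (leOfHom i.unop) m).symm) } :
      (Scheme.Modules.toPresheafOfModules X).obj M ⟶
        (Scheme.Modules.toPresheafOfModules X).obj N)
  exact congr(($this).app (op U) m)

end HomFunctor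

/-! ### Exactness of `ℋom(M, -)` for locally free `M` -/

section LocallyFree

variable {X : Scheme.{u}} {M N E Q : X.Modules}

/-- The sections `b i` of `M` over `U` form a basis of the module `M(V)` for every `V ⊆ U`. -/
def IsBasisOn {U : X.Opens} {ι : Type*} [Fintype ι] (b : ι → Γ(M, U)) : Prop :=
  ∀ (V : X.Opens) (h : V ≤ U),
    Function.Bijective fun a : ι → Γ(X, V) => ∑ i, a i • res M h (b i)

/-- A sheaf of modules that is locally free of finite rank. -/
def IsLocallyFree (M : X.Modules) : Prop :=
  ∀ x : X, ∃ (U : X.Opens) (_ : x ∈ U) (n : ℕ) (b : Fin n → Γ(M, U)), IsBasisOn b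

theorem res_sum_smul (M : X.Modules) {U V : X.Opens} (h : V ≤ U) {ι : Type*} [Fintype ι]
    (a : ι → Γ(X, U)) (m : ι → Γ(M, U)) :
    res M h (∑ i, a i • m i) = ∑ i, X.presheaf.map (homOfLE h).op (a i) • res M h (m i) := by
  refine (map_sum (M.presheaf.map (homOfLE h).op).hom _ _).trans ?_
  exact Finset.sum_congr rfl fun i _ => res_smul M h _ _

variable {ι : Type*} [Fintype ι] {U : X.Opens} {b : ι → Γ(M, U)}

theorem IsBasisOn.restrict (hb : IsBasisOn b) {U' : X.Opens} (h : U' ≤ U) :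
    IsBasisOn fun i => res M h (b i) := fun V h' => by
  simpa only [res_res] using hb V (h'.trans h)

/-- Coordinates with respect to a basis. -/
def IsBasisOn.coord (hb : IsBasisOn b) {V : X.Opens} (h : V ≤ U) (m : Γ(M, V)) :
    ι → Γ(X, V) := (Equiv.ofBijective _ (hb V h)).symm m

theorem IsBasisOn.sum_coord (hb : IsBasisOn b) {V : X.Opens} (h : V ≤ U) (m : Γ(M, V)) :
    ∑ i, hb.coord h m i • res M h (b i) = m := (Equiv.ofBijective _ (hb V h)).apply_symm_apply m

theorem IsBasisOn.coord_unique (hb : IsBasisOn b) {V : X.Opens} (h : V ≤ U) {m : Γ(M, V)}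
    {a : ι → Γ(X, V)} (ha : ∑ i, a i • res M h (b i) = m) : hb.coord h m = a :=
  (hb V h).1 ((hb.sum_coord h m).trans ha.symm)

/-- The local morphism with prescribed values on a basis. -/
def IsBasisOn.lift (hb : IsBasisOn b) (n : ι → Γ(N, U)) : LocalHom M N U :=
  ⟨fun V =>
    { toFun := fun m => ∑ i, hb.coord V.2 m i • res N V.2 (n i)
      map_add' := fun m m' => by
        rw [hb.coord_unique V.2 (m := m + m') (a := hb.coord V.2 m + hb.coord V.2 m')]
        · simp [add_smul, Finset.sum_add_distrib]
        · simp [add_smul, Finset.sum_add_distrib, hb.sum_coord]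
      map_smul' := fun r m => by
        rw [hb.coord_unique V.2 (m := r • m) (a := r • hb.coord V.2 m)]
        · simp [mul_smul, Finset.smul_sum]
        · simp only [Pi.smul_apply, smul_eq_mul, mul_smul, ← Finset.smul_sum, hb.sum_coord] },
    fun V W h m => by
      change res N h (∑ i, hb.coord V.2 m i • res N V.2 (n i)) =
        ∑ i, hb.coord W.2 (res M h m) i • res N W.2 (n i)
      rw [res_sum_smul, hb.coord_unique W.2 (m := res M h m)
        (a := fun i => X.presheaf.map (homOfLE h).op (hb.coord V.2 m i))]
      · simp only [res_res]
      · have := congrArg (res M h) (hb.sum_coord V.2 m)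
        rw [res_sum_smul] at this
        simpa only [res_res] using this⟩

theorem IsBasisOn.lift_ev (hb : IsBasisOn b) (n : ι → Γ(N, U)) {V : X.Opens} (h : V ≤ U)
    (m : Γ(M, V)) :
    LocalHom.ev (hb.lift n) h m = ∑ i, hb.coord h m i • res N h (n i) := rfl

theorem LocalHom.ev_eq_sum (hb : IsBasisOn b) (φ : LocalHom M N U) {V : X.Opens} (h : V ≤ U)
    (m : Γ(M, V)) :
    LocalHom.ev φ h m = ∑ i, hb.coord h m i • res N h (LocalHom.ev φ le_rfl (b i)) := by
  conv_lhs => rw [← hb.sum_coord h m]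
  rw [map_sum]
  refine Finset.sum_congr rfl fun i _ => ?_
  rw [map_smul, LocalHom.res_ev]

theorem LocalHom.ext_basis (hb : IsBasisOn b) {φ ψ : LocalHom M N U}
    (h : ∀ i, LocalHom.ev φ le_rfl (b i) = LocalHom.ev ψ le_rfl (b i)) : φ = ψ :=
  LocalHom.ext fun V hV m => by
    rw [LocalHom.ev_eq_sum hb, LocalHom.ev_eq_sum hb]
    simp only [h]

theorem IsBasisOn.lift_basis (hb : IsBasisOn b) (n : ι → Γ(N, U)) (i : ι) :
    LocalHom.ev (hb.lift n) le_rfl (b i) = n i := by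
  classical
  -- The coordinates of the `i`-th basis section are those of the `i`-th standard vector.
  rw [hb.lift_ev, hb.coord_unique le_rfl (a := Pi.single i 1)]
  · rw [Finset.sum_eq_single i]
    · rw [Pi.single_eq_same, one_smul, res_self]
    · intro j _ hj; rw [Pi.single_eq_of_ne hj, zero_smul]
    · simp
  · rw [Finset.sum_eq_single i]
    · rw [Pi.single_eq_same, one_smul, res_self]
    · intro j _ hj; rw [Pi.single_eq_of_ne hj, zero_smul]
    · simp

theorem exists_le_of_finite {X : Type*} [TopologicalSpace X] {ι : Type*} [Finite ι]
    {x : X} (W : ι → Opens X) (hW : ∀ i, x ∈ W i) :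
    ∃ V : Opens X, x ∈ V ∧ ∀ i, V ≤ W i :=
  ⟨⟨⋂ i, (W i : Set X), isOpen_iInter_of_finite fun i => (W i).2⟩,
    Set.mem_iInter.2 hW, fun i => Set.iInter_subset (fun i => (W i : Set X)) i⟩

/-- The images of the basis sections lift locally. There are finitely many of them, so one
neighbourhood serves for all, and the lifts prescribe a morphism on it. -/
theorem IsLocallyFree.exists_lift (hM : IsLocallyFree M) (p : E ⟶ Q) [Epi p] {U : X.Opens}
    (φ : LocalHom M Q U) {x : X} (hx : x ∈ U) :
    ∃ (V : X.Opens) (h : V ≤ U), x ∈ V ∧ ∃ ψ : LocalHom M E V,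
      LocalHom.postcomp p V ψ = LocalHom.restrict h φ := by
  obtain ⟨U₀, hx₀, n, b, hb⟩ := hM x
  have hb' := hb.restrict (inf_le_right : U ⊓ U₀ ≤ U₀)
  have key := fun i => modules_locally_lift p
    (LocalHom.ev φ inf_le_left (res M (inf_le_right : U ⊓ U₀ ≤ U₀) (b i)))
    (x := x) ⟨hx, hx₀⟩
  choose W hW hxW e he using key
  obtain ⟨V₀, hxV, hV₀⟩ := exists_le_of_finite W hxW
  have hV : V₀ ⊓ (U ⊓ U₀) ≤ U ⊓ U₀ := inf_le_right
  have hbV := hb'.restrict hV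
  refine ⟨V₀ ⊓ (U ⊓ U₀), hV.trans inf_le_left, ⟨hxV, hx, hx₀⟩,
    hbV.lift fun i => res E (inf_le_left.trans (hV₀ i)) (e i), ?_⟩
  refine LocalHom.ext_basis hbV fun i => ?_
  rw [LocalHom.restrict_ev, LocalHom.postcomp_ev, hbV.lift_basis, res_app, he, res_res,
    ← LocalHom.res_ev φ inf_le_left hV]

theorem LocalHom.postcomp_injective (i : N ⟶ E) [Mono i] (U : X.Opens) :
    Function.Injective (LocalHom.postcomp (M := M) i U) := fun _ _ h =>
  LocalHom.ext fun V hV m => modules_app_injective i V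
    congr(LocalHom.ev $h hV m)

/-- Preimages under `S.f` exist section by section and are unique, so choosing them is automatically
linear and compatible with restriction. -/
theorem LocalHom.exists_postcomp_eq {S : ShortComplex X.Modules} (hS : S.ShortExact)
    {U : X.Opens} (φ : LocalHom M S.X₂ U) (h : LocalHom.postcomp S.g U φ = 0) :
    ∃ ψ : LocalHom M S.X₁ U, LocalHom.postcomp S.f U ψ = φ := by
  have := hS.mono_f
  have key : ∀ (V : X.Opens) (hV : V ≤ U) (m : Γ(M, V)),
      ∃ a, S.f.app V a = LocalHom.ev φ hV m := fun V hV m =>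
    modules_shortExact_sections hS _ congr(LocalHom.ev $h hV m)
  choose g hg using key
  refine ⟨⟨fun V =>
    { toFun := g V.1 V.2
      map_add' := fun m m' => modules_app_injective S.f V.1 ?_
      map_smul' := fun r m => modules_app_injective S.f V.1 ?_ }, fun V W h m =>
        modules_app_injective S.f W.1 ?_⟩, LocalHom.ext fun V hV m => hg V hV m⟩
  · rw [map_add, hg, hg, hg, map_add]
  · rw [RingHom.id_apply, Scheme.Modules.Hom.app_smul, hg, hg, map_smul]
  · change S.f.app W.1 (res S.X₁ h (g V.1 V.2 m)) = S.f.app W.1 (g W.1 W.2 (res M h m))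
    rw [res_app, hg, hg, LocalHom.res_ev]

/-- Left exactness holds for every `M`; local freeness enters only in the local surjectivity on the
right. -/
theorem IsLocallyFree.shortExact_map (hM : IsLocallyFree M) {S : ShortComplex X.Modules}
    (hS : S.ShortExact) : (S.map (homFunctor M)).ShortExact := by
  have := hS.mono_f
  have := hS.epi_g
  refine abSheaf_shortExact_of_sections (fun U => LocalHom.postcomp_injective S.f U)
    (fun U φ hφ x hx => ?_) fun U φ x hx => ?_
  · obtain ⟨ψ, hψ⟩ := LocalHom.exists_postcomp_eq hS φ hφ
    exact ⟨U, le_rfl, hx, ψ, hψ.trans (abRes_self (homSheaf M S.X₂) φ).symm⟩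
  · obtain ⟨V, hV, hxV, ψ, hψ⟩ := hM.exists_lift S.g φ hx
    exact ⟨V, hV, hxV, ψ, hψ⟩

theorem IsLocallyFree.preservesFiniteLimits (hM : IsLocallyFree M) :
    Limits.PreservesFiniteLimits (homFunctor M) :=
  (((homFunctor M).exact_tfae.out 0 3 rfl rfl).1 fun _ hS => hM.shortExact_map hS).1

theorem IsLocallyFree.preservesFiniteColimits (hM : IsLocallyFree M) :
    Limits.PreservesFiniteColimits (homFunctor M) :=
  (((homFunctor M).exact_tfae.out 0 3 rfl rfl).1 fun _ hS => hM.shortExact_map hS).2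

end LocallyFree

/-! ### Extension classes and dimension shifting -/

section AbelianExt

open Limits Abelian

universe w v v'

variable {C : Type v} [Category.{v'} C] [Abelian C]

/-- A map into the pullback that is killed by the projection to `Y` amounts to a map into `S.X₂`
killed by `S.g`, so the kernel of that projection is again `S.X₁`. -/
theorem exists_pullback_shortExact {S : ShortComplex C} (hS : S.ShortExact) {Y : C}
    (q : Y ⟶ S.X₃) :
    ∃ (E : C) (i : S.X₁ ⟶ E) (p : E ⟶ Y) (k : E ⟶ S.X₂) (w : i ≫ p = 0)
      (_ : (ShortComplex.mk i p w).ShortExact), i ≫ k = S.f ∧ IsPullback k p S.g q := by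
  have := hS.epi_g
  have := hS.mono_f
  let i : S.X₁ ⟶ pullback S.g q := pullback.lift S.f 0 (by simp)
  have hi : i ≫ pullback.fst S.g q = S.f := pullback.lift_fst _ _ _
  have w : i ≫ pullback.snd S.g q = 0 := pullback.lift_snd _ _ _
  have hi' : Mono i := mono_of_mono_fac hi
  refine ⟨pullback S.g q, i, pullback.snd S.g q, pullback.fst S.g q, w, ⟨?_⟩, hi,
    IsPullback.of_hasPullback _ _⟩
  refine ShortComplex.exact_of_f_is_kernel _ (KernelFork.IsLimit.ofι' _ _ fun k hk => ?_)
  have hk' : (k ≫ pullback.fst S.g q) ≫ S.g = 0 := by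
    rw [Category.assoc, pullback.condition, ← Category.assoc]
    exact (congrArg (· ≫ q) hk).trans zero_comp
  refine ⟨hS.exact.lift _ hk', ?_⟩
  apply pullback.hom_ext
  · exact (Category.assoc _ _ _).trans ((congrArg _ hi).trans (hS.exact.lift_f _ hk'))
  · exact (Category.assoc _ _ _).trans ((congrArg _ w).trans (comp_zero.trans hk.symm))

theorem exists_shortExact_injective [EnoughInjectives C] (A : C) :
    ∃ (I Q : C) (f : A ⟶ I) (g : I ⟶ Q) (w : f ≫ g = 0), Injective I ∧
      (ShortComplex.mk f g w).ShortExact :=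
  ⟨_, _, Injective.ι A, cokernel.π _, cokernel.condition _, inferInstance,
    ⟨ShortComplex.exact_of_g_is_cokernel _ (cokernelIsCokernel _)⟩⟩

variable [HasExt.{w} C]

/-- Naturality of the class for a morphism of extensions that is the identity on the subobject. -/
theorem extClass_of_map {A E M T₂ T₃ : C} {i : A ⟶ E} {p : E ⟶ M} {w : i ≫ p = 0}
    (hS : (ShortComplex.mk i p w).ShortExact) {f : A ⟶ T₂} {g : T₂ ⟶ T₃} {w' : f ≫ g = 0}
    (hT : (ShortComplex.mk f g w').ShortExact) (k : E ⟶ T₂) (q : M ⟶ T₃) (h₁ : i ≫ k = f)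
    (h₂ : k ≫ g = p ≫ q) : hS.extClass = (Ext.mk₀ q).comp hT.extClass (zero_add 1) := by
  have := ShortComplex.ShortExact.extClass_naturality hS hT
    { τ₁ := 𝟙 A, τ₂ := k, τ₃ := q, comm₁₂ := by simp [h₁], comm₂₃ := h₂ }
  rw [← this]
  exact (Ext.comp_mk₀_id _).symm

/-- Exactness of the covariant `Ext` sequence at `Ext¹(M, S.X₁)`, with `Ext⁰` read as `Hom`. If
`S.X₂` is injective, the condition on `x` holds automatically. -/
theorem exists_comp_extClass {M : C} {S : ShortComplex C} (hS : S.ShortExact)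
    (x : Ext M S.X₁ 1) (hx : x.comp (Ext.mk₀ S.f) (add_zero 1) = 0) :
    ∃ q : M ⟶ S.X₃, x = (Ext.mk₀ q).comp hS.extClass (zero_add 1) := by
  obtain ⟨x₃, rfl⟩ := Ext.covariant_sequence_exact₁ M hS x hx (zero_add 1)
  obtain ⟨q, rfl⟩ := (Ext.mk₀_bijective _ _).2 x₃
  exact ⟨q, rfl⟩

theorem exists_lift_of_comp_extClass_eq_zero {M : C} {S : ShortComplex C} (hS : S.ShortExact)
    (q : M ⟶ S.X₃) (hq : (Ext.mk₀ q).comp hS.extClass (zero_add 1) = 0) :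
    ∃ r : M ⟶ S.X₂, r ≫ S.g = q := by
  obtain ⟨x₂, hx₂⟩ := Ext.covariant_sequence_exact₃ M hS _ (zero_add 1) hq
  obtain ⟨r, rfl⟩ := (Ext.mk₀_bijective _ _).2 x₂
  rw [Ext.mk₀_comp_mk₀] at hx₂
  exact ⟨r, (Ext.mk₀_bijective _ _).1 hx₂⟩

theorem comp_extClass_eq_zero {M : C} {S : ShortComplex C} (hS : S.ShortExact)
    (r : M ⟶ S.X₂) : (Ext.mk₀ (r ≫ S.g)).comp hS.extClass (zero_add 1) = 0 := by
  rw [← Ext.mk₀_comp_mk₀, Ext.comp_assoc (a₂₃ := 1) _ _ _ (by lia) (by lia) (by lia),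
    ShortComplex.ShortExact.comp_extClass, Ext.comp_zero]

/-- Write the class as a pullback of an embedding of `N` into an injective, then pull back the
actual extension. -/
theorem exists_eq_extClass [EnoughInjectives C] {M N : C} (x : Ext M N 1) :
    ∃ (E : C) (i : N ⟶ E) (p : E ⟶ M) (w : i ≫ p = 0)
      (hS : (ShortComplex.mk i p w).ShortExact), hS.extClass = x := by
  obtain ⟨I, Q, f, g, w, hI, hT⟩ := exists_shortExact_injective N
  obtain ⟨q, rfl⟩ := exists_comp_extClass hT x (Ext.eq_zero_of_injective _)
  obtain ⟨E, i, p, k, w', hE, hik, hk⟩ := exists_pullback_shortExact hT q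
  exact ⟨E, i, p, w', hE, extClass_of_map hE hT k q hik hk.w⟩

end AbelianExt

/-! ### `ℤ_X`, global sections and `H¹` -/

section ConstantSheaf

open Limits Abelian

variable {X : Scheme.{u}}

theorem abRes_constOne {U V : X.Opens} (h : V ≤ U) :
    abRes (constInt X) h (constOne U) = constOne V :=
  congr($((CategoryTheory.toSheafify (Opens.grothendieckTopology X)
    ((Functor.const _).obj (AddCommGrpCat.of (ULift.{u} ℤ)))).naturality (homOfLE h).op)
      (ULift.up (1 : ℤ))).symm

/-- `ℤ_X` is the sheafification of the constant presheaf `ℤ`, which the section `1` generates. -/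
theorem constInt_hom_ext {F : AbSheaf X.carrier} {f g : constInt X ⟶ F}
    (h : f.hom.app (op ⊤) (constOne ⊤) = g.hom.app (op ⊤) (constOne ⊤)) : f = g := by
  refine Sheaf.hom_ext (sheafify_hom_ext _ f.hom g.hom F.property ?_)
  refine NatTrans.ext (funext fun U => AddCommGrpCat.hom_ext (AddMonoidHom.ext fun n => ?_))
  have key : f.hom.app (op U.unop) (constOne U.unop) = g.hom.app (op U.unop) (constOne U.unop) := by
    rw [← abRes_constOne le_top, abRes_app, abRes_app, h]
  have hn : n = n.down • (ULift.up (1 : ℤ) : ULift.{u} ℤ) :=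
    ULift.ext _ _ (by simp)
  rw [hn, map_zsmul, map_zsmul]
  exact congrArg (n.down • ·) key

/-- The morphism from the constant presheaf `ℤ` given by a global section. -/
def constPresheafHom (F : AbSheaf X.carrier) (s : F.obj.obj (op (⊤ : Opens X.carrier))) :
    (Functor.const _).obj (AddCommGrpCat.of (ULift.{u} ℤ)) ⟶ F.obj where
  app U := AddCommGrpCat.ofHom
    (((zmultiplesHom _) (abRes F (le_top : U.unop ≤ ⊤) s)).comp
      AddEquiv.ulift.toAddMonoidHom : ULift.{u} ℤ →+ F.obj.obj U)
  naturality U V i := AddCommGrpCat.hom_ext (AddMonoidHom.ext fun n => by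
    change n.down • abRes F le_top s =
      F.obj.map (homOfLE (leOfHom i.unop)).op (n.down • abRes F le_top s)
    rw [map_zsmul]
    exact congrArg (n.down • ·) (abRes_abRes F le_top (leOfHom i.unop) s).symm)

/-- The morphism from the constant sheaf `ℤ` given by a global section. -/
def constHom (F : AbSheaf X.carrier) (s : F.obj.obj (op (⊤ : Opens X.carrier))) :
    constInt X ⟶ F :=
  ⟨sheafifyLift (Opens.grothendieckTopology X) (constPresheafHom F s) F.property⟩

theorem constHom_app_constOne (F : AbSheaf X.carrier)
    (s : F.obj.obj (op (⊤ : Opens X.carrier))) (U : X.Opens) :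
    (constHom F s).hom.app (op U) (constOne U) = abRes F le_top s := by
  have h := toSheafify_sheafifyLift (Opens.grothendieckTopology X) (constPresheafHom F s)
    F.property
  refine (congr($(h).app (op U) (ULift.up (1 : ℤ)))).trans ?_
  exact one_zsmul (abRes F le_top s)

theorem constHom_app_constOne_top (F : AbSheaf X.carrier)
    (s : F.obj.obj (op (⊤ : Opens X.carrier))) :
    (constHom F s).hom.app (op ⊤) (constOne ⊤) = s :=
  (constHom_app_constOne F s ⊤).trans (abRes_self F s)

/-- Embed `F` in an injective `I` with quotient `Q`. Both extensions map to `0 → F → I → Q → 0`, so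
both classes are pullbacks of its class along maps `ψ, ψ' : ℤ_X ⟶ Q`. The common cocycle forces `ψ -
ψ'` to lift to `I`, and so to contribute nothing. -/
theorem IsRepresentedBy.unique {F : AbSheaf X.carrier} {h h' : Sheaf.H F 1} {ι : Type u}
    {U : ι → X.Opens} {c : ∀ i j, F.obj.obj (op (U i ⊓ U j))} (H : IsRepresentedBy F h U c)
    (H' : IsRepresentedBy F h' U c) : h = h' := by
  obtain ⟨hU, G, f, g, w, hS, t, ht, htc, rfl⟩ := H
  obtain ⟨-, G', f', g', w', hS', t', ht', htc', rfl⟩ := H'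
  obtain ⟨I, Q, j, π, wj, hI, hT⟩ := exists_shortExact_injective F
  have := hS.mono_f
  have := hS'.mono_f
  have := hS.epi_g
  have := hS'.epi_g
  have hφ : f ≫ Injective.factorThru j f = j := Injective.comp_factorThru _ _
  have hφ' : f' ≫ Injective.factorThru j f' = j := Injective.comp_factorThru _ _
  set φ := Injective.factorThru j f
  set φ' := Injective.factorThru j f'
  have hz : f ≫ φ ≫ π = 0 := by rw [← Category.assoc, hφ, wj]
  have hz' : f' ≫ φ' ≫ π = 0 := by rw [← Category.assoc, hφ', wj]
  have hψ : g ≫ hS.exact.desc (φ ≫ π) hz = φ ≫ π := hS.exact.g_desc _ _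
  have hψ' : g' ≫ hS'.exact.desc (φ' ≫ π) hz' = φ' ≫ π := hS'.exact.g_desc _ _
  set ψ := hS.exact.desc (φ ≫ π) hz
  set ψ' := hS'.exact.desc (φ' ≫ π) hz'
  rw [extClass_of_map hS hT φ ψ hφ hψ.symm, extClass_of_map hS' hT φ' ψ' hφ' hψ'.symm]
  -- Both `φ (t i)` and `φ' (t' i)` have the coboundary `j (c i k)`, so their differences agree on
  -- overlaps.
  have glue := abSheaf_exists_glue I U hU
    (fun i => φ.hom.app _ (t i) - φ'.hom.app _ (t' i)) fun i k => by
      rw [abRes_sub, abRes_sub, ← abRes_app, ← abRes_app, ← abRes_app, ← abRes_app,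
        sub_eq_sub_iff_sub_eq_sub]
      have h₁ := congrArg (φ.hom.app _) (htc i k)
      have h₂ := congrArg (φ'.hom.app _) (htc' i k)
      have e₁ : φ.hom.app _ (f.hom.app _ (c i k)) = j.hom.app _ (c i k) :=
        congr(($hφ).hom.app _ (c i k))
      have e₂ : φ'.hom.app _ (f'.hom.app _ (c i k)) = j.hom.app _ (c i k) :=
        congr(($hφ').hom.app _ (c i k))
      rw [e₁, map_sub] at h₁
      rw [e₂, map_sub] at h₂
      have := h₁.symm.trans h₂
      rw [← neg_inj, neg_sub, neg_sub] at this
      exact this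
  obtain ⟨s, hs⟩ := glue
  -- On `U i` the values of `ψ` and `ψ'` at `1` are the images in `Q` of `φ (t i)` and `φ' (t' i)`,
  -- which differ by `s`.
  have key : ψ = ψ' + constHom I s ≫ π := by
    apply constInt_hom_ext
    refine abSheaf_eq_of_locally_eq Q fun x _ => ?_
    obtain ⟨i, hi⟩ : ∃ i, x ∈ U i := by
      rw [← Opens.mem_iSup, hU]; trivial
    refine ⟨U i, le_top, hi, ?_⟩
    rw [← abRes_app, ← abRes_app, abRes_constOne]
    have e₁ : ψ.hom.app _ (constOne (U i)) = π.hom.app _ (φ.hom.app _ (t i)) := by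
      rw [← ht]; exact congr(($hψ).hom.app _ (t i))
    have e₂ : ψ'.hom.app _ (constOne (U i)) = π.hom.app _ (φ'.hom.app _ (t' i)) := by
      rw [← ht']; exact congr(($hψ').hom.app _ (t' i))
    have e₃ : (ψ' + constHom I s ≫ π).hom.app _ (constOne (U i)) = ψ'.hom.app _ (constOne (U i)) +
      π.hom.app _ ((constHom I s).hom.app _ (constOne (U i))) := rfl
    rw [e₃, e₁, e₂, constHom_app_constOne, hs, map_sub, add_sub_cancel]
  rw [key, Ext.mk₀_add, Ext.add_comp, add_eq_left]
  exact comp_extClass_eq_zero hT (constHom I s)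

/-- The class is the pullback of `0 → F → I → Q → 0` along a global section of `Q`. Flasqueness of
`F` makes that section lift to `I`. -/
theorem subsingleton_H_of_isFlasque (F : AbSheaf X.carrier) [hF : TopCat.Presheaf.IsFlasque F.obj]
    (y : Sheaf.H F 1) : y = 0 := by
  obtain ⟨I, Q, j, π, wj, hI, hT⟩ := exists_shortExact_injective F
  obtain ⟨q, rfl⟩ := exists_comp_extClass hT y (Ext.eq_zero_of_injective _)
  have hF' : TopCat.Sheaf.IsFlasque (ShortComplex.mk j π wj).X₁ := hF
  have hsurj := (AddCommGrpCat.epi_iff_surjective _).1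
    (TopCat.Sheaf.IsFlasque.epi_of_shortExact (U := ⊤) hT)
  obtain ⟨s, hs⟩ := hsurj (q.hom.app (op ⊤) (constOne ⊤))
  have : q = constHom I s ≫ π := by
    apply constInt_hom_ext
    rw [← hs]
    exact congrArg (π.hom.app (op ⊤)) (constHom_app_constOne_top I s).symm
  rw [this]
  exact comp_extClass_eq_zero hT (constHom I s)

end ConstantSheaf

theorem modules_exists_glue {X : Scheme.{u}} (M : X.Modules) {ι : Type u} (U : ι → X.Opens)
    {W : X.Opens} (hW : iSup U = W) (a : ∀ i, Γ(M, U i))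
    (h : ∀ i j, res M (inf_le_left : U i ⊓ U j ≤ U i) (a i) = res M inf_le_right (a j)) :
    ∃ b : Γ(M, W), ∀ i, res M (hW ▸ le_iSup U i) b = a i :=
  abSheaf_exists_glue ((toAbSheaf X).obj M) U hW a h

/-! ### Local morphisms out of an associated sheaf -/

section Sheafification

variable {X : Scheme.{u}} {M : X.Opens → Type u} [∀ U, AddCommGroup (M U)]
  [∀ U, Module Γ(X, U) (M U)]
  {r : ∀ {U V : X.Opens} (h : V ≤ U), M U →ₛₗ[(X.presheaf.map (homOfLE h).op).hom] M V}
  {r_id : ∀ (U : X.Opens) (m : M U), r le_rfl m = m}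
  {r_comp : ∀ {U V W : X.Opens} (h : V ≤ U) (h' : W ≤ V) (m : M U),
      r (h'.trans h) m = r h' (r h m)}

variable (r r_id r_comp) in
/-- The section of the associated sheaf given by a section of the presheaf. -/
def sheafifySection (U : X.Opens) :
    M U →ₗ[Γ(X, U)] Γ(sheafify.obj (mkPresheaf M r r_id r_comp), U) where
  toFun m := (toSheafify (mkPresheaf M r r_id r_comp)).app (op U) m
  map_add' := map_add ((toSheafify (mkPresheaf M r r_id r_comp)).app (op U)).hom
  map_smul' := map_smul ((toSheafify (mkPresheaf M r r_id r_comp)).app (op U)).hom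

theorem res_sheafifySection {U V : X.Opens} (h : V ≤ U) (m : M U) :
    res _ h (sheafifySection r r_id r_comp U m) = sheafifySection r r_id r_comp V (r h m) :=
  (congr($((toSheafify (mkPresheaf M r r_id r_comp)).naturality (homOfLE h).op) m)).symm

theorem exists_sheafifySection_eq {U : X.Opens}
    (s : Γ(sheafify.obj (mkPresheaf M r r_id r_comp), U)) {x : X} (hx : x ∈ U) :
    ∃ (V : X.Opens) (h : V ≤ U), x ∈ V ∧ ∃ m, sheafifySection r r_id r_comp V m = res _ h s := by
  have h : Presheaf.IsLocallySurjective (Opens.grothendieckTopology X)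
      (CategoryTheory.toSheafify (Opens.grothendieckTopology X)
        (mkPresheaf M r r_id r_comp).presheaf) := inferInstance
  obtain ⟨V, hV, ⟨a, ha⟩, hxV⟩ :=
    (TopCat.Presheaf.isLocallySurjective_iff _).1 h U s x hx
  exact ⟨V, hV, hxV, a, ha⟩

theorem exists_restrict_eq_zero {U : X.Opens} (m : M U)
    (hm : sheafifySection r r_id r_comp U m = 0) {x : X} (hx : x ∈ U) :
    ∃ (V : X.Opens) (h : V ≤ U), x ∈ V ∧ r h m = 0 := by
  have h := Presheaf.equalizerSieve_mem (Opens.grothendieckTopology X)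
      (CategoryTheory.toSheafify (Opens.grothendieckTopology X)
        (mkPresheaf M r r_id r_comp).presheaf) (X := op U) m (0 : M U)
        (hm.trans (map_zero (sheafifySection r r_id r_comp U)).symm)
  obtain ⟨V, f, hf, hxV⟩ := h x hx
  exact ⟨V, leOfHom f, hxV, (show r (leOfHom f) m = r (leOfHom f) 0 from hf).trans (map_zero _)⟩

theorem sheafifyDesc_sheafifySection {N : X.Modules}
    (f : mkPresheaf M r r_id r_comp ⟶ (Scheme.Modules.toPresheafOfModules X).obj N)
    (U : X.Opens) (m : M U) :
    (sheafifyDesc f).app U (sheafifySection r r_id r_comp U m) = f.app (op U) m := by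
  have := (sheafifyAdj.homEquiv _ N).apply_symm_apply f
  rw [Adjunction.homEquiv_unit] at this
  exact congr(($this).app (op U) m)

theorem sheafify_map_sheafifySection {N : X.Opens → Type u} [∀ U, AddCommGroup (N U)]
    [∀ U, Module Γ(X, U) (N U)]
    {s : ∀ {U V : X.Opens} (h : V ≤ U), N U →ₛₗ[(X.presheaf.map (homOfLE h).op).hom] N V}
    {s_id s_comp} (f : mkPresheaf M r r_id r_comp ⟶ mkPresheaf N s s_id s_comp) (U : X.Opens)
    (m : M U) :
    (sheafify.map f).app U (sheafifySection r r_id r_comp U m) =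
      sheafifySection s s_id s_comp U (f.app (op U) m) :=
  (congr(($(sheafifyAdj.unit.naturality f)).app (op U) m)).symm

theorem sheafify_hom_ext {N : X.Modules} {f g : sheafify.obj (mkPresheaf M r r_id r_comp) ⟶ N}
    (h : ∀ U m, f.app U (sheafifySection r r_id r_comp U m) =
      g.app U (sheafifySection r r_id r_comp U m)) : f = g := by
  refine Scheme.Modules.hom_ext _ _ fun U => ConcreteCategory.hom_ext _ _ fun s => ?_
  refine modules_eq_of_locally_eq N fun x hx => ?_
  obtain ⟨V, hV, hxV, m, hm⟩ := exists_sheafifySection_eq s hx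
  refine ⟨V, hV, hxV, ?_⟩
  rw [← res_app, ← res_app, ← hm, h]

theorem LocalHom.ext_sheafifySection {N : X.Modules} {U : X.Opens}
    {φ ψ : LocalHom (sheafify.obj (mkPresheaf M r r_id r_comp)) N U}
    (H : ∀ (V : X.Opens) (h : V ≤ U) (m : M V),
      LocalHom.ev φ h (sheafifySection r r_id r_comp V m) =
        LocalHom.ev ψ h (sheafifySection r r_id r_comp V m)) : φ = ψ := by
  refine LocalHom.ext fun V h s => modules_eq_of_locally_eq N fun x hx => ?_
  obtain ⟨W, hW, hxW, m, hm⟩ := exists_sheafifySection_eq s hx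
  refine ⟨W, hW, hxW, ?_⟩
  rw [LocalHom.res_ev, LocalHom.res_ev, ← hm, H]

/-- The universal property of sheafification over an open subset `U`, where the adjunction, which
concerns global morphisms, does not directly apply. The value on a section is glued from the values
on its local representatives. -/
theorem LocalHom.exists_of_presheaf {N : X.Modules} {U : X.Opens}
    (l : ∀ V : X.Opens, V ≤ U → M V →ₗ[Γ(X, V)] Γ(N, V))
    (hl : ∀ (V W : X.Opens) (h : V ≤ U) (h' : W ≤ V) (m : M V),
      res N h' (l V h m) = l W (h'.trans h) (r h' m)) :
    ∃ φ : LocalHom (sheafify.obj (mkPresheaf M r r_id r_comp)) N U,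
      ∀ (V : X.Opens) (h : V ≤ U) (m : M V),
        LocalHom.ev φ h (sheafifySection r r_id r_comp V m) = l V h m := by
  -- A presheaf section that dies in the associated sheaf is locally zero, so its image under `l` is
  -- locally zero.
  have inj : ∀ (V : X.Opens) (h : V ≤ U) (m : M V), sheafifySection r r_id r_comp V m = 0 →
      l V h m = 0 := fun V h m hm => modules_eq_of_locally_eq N fun x hx => by
    obtain ⟨W, hW, hxW, hm'⟩ := exists_restrict_eq_zero m hm hx
    refine ⟨W, hW, hxW, ?_⟩
    rw [hl, hm', map_zero]
    exact (map_zero (N.presheaf.map (homOfLE hW).op).hom).symm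
  -- The value `n` is right for `s` if it restricts to `l m` wherever `m` represents `s`. This pins
  -- `n` down, and linearity and compatibility follow from uniqueness.
  let Rel (V : X.Opens) (h : V ≤ U) (s : Γ(sheafify.obj (mkPresheaf M r r_id r_comp), V))
    (n : Γ(N, V)) : Prop := ∀ (W : X.Opens) (hW : W ≤ V) (m : M W),
      sheafifySection r r_id r_comp W m = res _ hW s → res N hW n = l W (hW.trans h) m
  have uniq : ∀ V h s n n', Rel V h s n → Rel V h s n' → n = n' := fun V h s n n' hn hn' =>
    modules_eq_of_locally_eq N fun x hx => by
      obtain ⟨W, hW, hxW, m, hm⟩ := exists_sheafifySection_eq s hx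
      exact ⟨W, hW, hxW, (hn W hW m hm).trans (hn' W hW m hm).symm⟩
  have ex : ∀ V h s, ∃ n, Rel V h s n := by
    intro V h s
    choose W hW hxW m hm using fun x : V => exists_sheafifySection_eq s x.2
    have agree : ∀ (W₁ W₂ W₃ : X.Opens) (h₁ : W₁ ≤ V) (h₂ : W₂ ≤ V) (h₁' : W₃ ≤ W₁)
        (h₂' : W₃ ≤ W₂) (m₁ : M W₁) (m₂ : M W₂),
        sheafifySection r r_id r_comp W₁ m₁ = res _ h₁ s →
        sheafifySection r r_id r_comp W₂ m₂ = res _ h₂ s →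
        res N h₁' (l W₁ (h₁.trans h) m₁) = res N h₂' (l W₂ (h₂.trans h) m₂) := by
      intro W₁ W₂ W₃ h₁ h₂ h₁' h₂' m₁ m₂ e₁ e₂
      rw [hl, hl, ← sub_eq_zero, ← map_sub]
      apply inj
      rw [map_sub, ← res_sheafifySection, ← res_sheafifySection, e₁, e₂, res_res, res_res,
        sub_self]
    obtain ⟨n, hn⟩ := modules_exists_glue N W (W := V)
      (le_antisymm (iSup_le hW) fun x hx => Opens.mem_iSup.2 ⟨⟨x, hx⟩, hxW _⟩)
      (fun x => l (W x) ((hW x).trans h) (m x))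
      (fun x y => agree _ _ _ (hW x) (hW y) _ _ _ _ (hm x) (hm y))
    refine ⟨n, fun W' hW' m' hm' => modules_eq_of_locally_eq N fun x hx => ?_⟩
    refine ⟨W' ⊓ W ⟨x, hW' hx⟩, inf_le_left, ⟨hx, hxW _⟩, ?_⟩
    rw [res_res, ← res_res N (hW ⟨x, hW' hx⟩) inf_le_right]
    refine (congrArg _ (hn ⟨x, hW' hx⟩)).trans ?_
    exact agree _ _ _ (hW _) hW' _ _ _ _ (hm _) hm'
  choose g hg using ex
  have add : ∀ V h s s' n n', Rel V h s n → Rel V h s' n' → Rel V h (s + s') (n + n') := by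
    intro V h s s' n n' hn hn' W hW m hm
    refine modules_eq_of_locally_eq N fun x hx => ?_
    obtain ⟨W₁, h₁, hx₁, m₁, hm₁⟩ := exists_sheafifySection_eq (res _ hW s) hx
    refine ⟨W₁, h₁, hx₁, ?_⟩
    rw [res_res] at hm₁
    -- If `m` represents `s + s'` and `m₁` represents `s`, then the difference represents `s'`.
    have hm₂ : sheafifySection r r_id r_comp W₁ (r h₁ m - m₁) = res _ (h₁.trans hW) s' := by
      rw [map_sub, ← res_sheafifySection, hm, hm₁, res_add, res_add, res_res, res_res,
        add_sub_cancel_left]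
    rw [hl, res_res, res_add, hn _ _ _ hm₁, hn' _ _ _ hm₂, ← map_add, add_sub_cancel]
  have smul : ∀ (V : X.Opens) (h : V ≤ U) (a : Γ(X, V))
      (s : Γ(sheafify.obj (mkPresheaf M r r_id r_comp), V)) (n : Γ(N, V)), Rel V h s n → Rel V h (a • s) (a • n) := by
    intro V h a s n hn W hW m hm
    refine modules_eq_of_locally_eq N fun x hx => ?_
    obtain ⟨W₁, h₁, hx₁, m₁, hm₁⟩ := exists_sheafifySection_eq (res _ hW s) hx
    refine ⟨W₁, h₁, hx₁, ?_⟩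
    rw [res_res] at hm₁
    rw [hl, res_res, res_smul, hn _ _ _ hm₁, ← map_smul, ← sub_eq_zero, ← map_sub]
    apply inj
    rw [map_sub, map_smul, ← res_sheafifySection, hm, hm₁, res_res, res_smul, sub_self]
  have self : ∀ (V : X.Opens) (h : V ≤ U) (m : M V),
      Rel V h (sheafifySection r r_id r_comp V m) (l V h m) := by
    intro V h m W hW m' hm'
    rw [hl, ← sub_eq_zero, ← map_sub]
    apply inj
    rw [map_sub, ← res_sheafifySection, hm', sub_self]
  refine ⟨⟨fun V =>
    { toFun := g V.1 V.2
      map_add' := fun s s' => uniq V.1 V.2 (s + s') _ _ (hg _ _ _)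
        (add V.1 V.2 s s' _ _ (hg _ _ _) (hg _ _ _))
      map_smul' := fun a s => uniq V.1 V.2 (a • s) _ _ (hg _ _ _)
        (smul V.1 V.2 a s _ (hg _ _ _)) },
    fun V W h s => uniq W.1 W.2 (res _ h s) _ _ (fun W' hW' m hm => ?_) (hg _ _ _)⟩,
    fun V h m => uniq V h _ _ _ (hg _ _ _) (self V h m)⟩
  rw [res_res] at hm
  exact (res_res N h hW' _).trans (hg V.1 V.2 s W' (hW'.trans h) m hm)

end Sheafification

/-! ### Extension by zero and flasqueness of `ℋom(M, I)` -/

section ExtensionByZero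

variable {X : Scheme.{u}} (M : X.Modules) (U : X.Opens)

/-- The sections of `M` over `V` that vanish unless `V ⊆ U`. -/
def zeroExtension (V : X.Opens) : Submodule Γ(X, V) Γ(M, V) where
  carrier := {m | ¬ V ≤ U → m = 0}
  zero_mem' _ := rfl
  add_mem' h h' hV := by rw [h hV, h' hV, add_zero]
  smul_mem' r m h hV := by rw [h hV, smul_zero]

/-- Restriction of sections of the extension by zero. -/
def zeroExtensionRes {V W : X.Opens} (h : W ≤ V) :
    zeroExtension M U V →ₛₗ[(X.presheaf.map (homOfLE h).op).hom] zeroExtension M U W where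
  toFun m := ⟨res M h m.1, fun hW => by
    rw [m.2 fun hV => hW (h.trans hV)]; exact map_zero (M.presheaf.map (homOfLE h).op).hom⟩
  map_add' m m' := Subtype.ext (res_add M h m.1 m'.1)
  map_smul' a m := Subtype.ext (res_smul M h a m.1)

theorem zeroExtensionRes_self (V : X.Opens) (m : zeroExtension M U V) :
    zeroExtensionRes M U le_rfl m = m := Subtype.ext (res_self M m.1)

theorem zeroExtensionRes_comp {V W W' : X.Opens} (h : W ≤ V) (h' : W' ≤ W)
    (m : zeroExtension M U V) : zeroExtensionRes M U (h'.trans h) m =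
      zeroExtensionRes M U h' (zeroExtensionRes M U h m) := Subtype.ext (res_res M h h' m.1).symm

/-- The presheaf whose associated sheaf is the extension by zero of `M|_U`. -/
def zeroExtensionPresheaf : X.PresheafOfModules :=
  mkPresheaf (fun V => zeroExtension M U V) (zeroExtensionRes M U)
    (zeroExtensionRes_self M U) (zeroExtensionRes_comp M U)

/-- The inclusion of the extension by zero. -/
def zeroExtensionHom :
    zeroExtensionPresheaf M U ⟶ (Scheme.Modules.toPresheafOfModules X).obj M where
  app V := (ModuleCat.ofHom (zeroExtension M U V.unop).subtype :
    ModuleCat.of Γ(X, V.unop) (zeroExtension M U V.unop) ⟶ ModuleCat.of Γ(X, V.unop) Γ(M, V.unop))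
  naturality _ := rfl

variable {M U} in
open Classical in
/-- The morphism from the extension by zero of `M|_U` given by a local morphism over `U`. -/
def LocalHom.fromZeroExtension {N : X.Modules} (φ : LocalHom M N U) :
    zeroExtensionPresheaf M U ⟶ (Scheme.Modules.toPresheafOfModules X).obj N where
  app V := (ModuleCat.ofHom
      ((if h : V.unop ≤ U then LocalHom.ev φ h else 0) ∘ₗ (zeroExtension M U V.unop).subtype) :
    ModuleCat.of Γ(X, V.unop) (zeroExtension M U V.unop) ⟶ ModuleCat.of Γ(X, V.unop) Γ(N, V.unop))
  naturality {V W} i := ModuleCat.hom_ext (LinearMap.ext fun m => by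
    have hi := leOfHom i.unop
    change (if h : W.unop ≤ U then LocalHom.ev φ h else 0) (res M hi m.1) =
      res N hi ((if h : V.unop ≤ U then LocalHom.ev φ h else 0) m.1)
    by_cases hV : V.unop ≤ U
    · rw [dif_pos hV, dif_pos (hi.trans hV), LocalHom.res_ev]
    · have h0 : ∀ M : X.Modules, res M hi 0 = 0 := fun M =>
        map_zero (M.presheaf.map (homOfLE hi).op).hom
      rw [m.2 hV, h0, map_zero, map_zero, h0])

variable {M U} in
open Classical in
theorem LocalHom.fromZeroExtension_app {N : X.Modules} (φ : LocalHom M N U) {V : X.Opens}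
    (h : V ≤ U) (m : zeroExtension M U V) :
    (LocalHom.fromZeroExtension φ).app (op V) m = LocalHom.ev φ h m.1 := by
  change (if h : V ≤ U then LocalHom.ev φ h else 0) m.1 = _
  rw [dif_pos h]

/-- Sections of the extension by zero come locally from the presheaf, where the map is an inclusion
of submodules. -/
theorem mono_zeroExtensionHom : Mono (sheafifyDesc (zeroExtensionHom M U)) := by
  refine modules_mono_of_app_injective _ fun V => ?_
  refine (injective_iff_map_eq_zero ((sheafifyDesc (zeroExtensionHom M U)).app V).hom).2
    fun s hs => modules_eq_of_locally_eq _ fun x hx => ?_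
  obtain ⟨W, hW, hxW, m, hm⟩ := exists_sheafifySection_eq s hx
  refine ⟨W, hW, hxW, ?_⟩
  have h0 : (sheafifyDesc (zeroExtensionHom M U)).app W
      (sheafifySection (zeroExtensionRes M U) (zeroExtensionRes_self M U)
        (zeroExtensionRes_comp M U) W m) = 0 := by
    rw [hm]
    refine (res_app _ hW s).trans ?_
    rw [show (sheafifyDesc (zeroExtensionHom M U)).app V s = 0 from hs]
    exact map_zero (M.presheaf.map (homOfLE hW).op).hom
  have h1 : m = 0 := Subtype.ext ((sheafifyDesc_sheafifySection (r_comp := zeroExtensionRes_comp M U)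
      (zeroExtensionHom M U) W m).symm.trans h0)
  refine hm.symm.trans ?_
  rw [h1, map_zero]
  exact (map_zero (Scheme.Modules.presheaf _ |>.map (homOfLE hW).op).hom).symm

variable {M U}

/-- A morphism `M|_U ⟶ I|_U` is a morphism from the extension by zero of `M|_U` to `I`. The
extension by zero is a subobject of `M`, so injectivity of `I` extends it to `M`. -/
theorem LocalHom.exists_extend {I : X.Modules} [Injective I] (φ : LocalHom M I U) :
    ∃ ψ : M ⟶ I, ∀ (V : X.Opens) (h : V ≤ U) (m : Γ(M, V)), ψ.app V m = LocalHom.ev φ h m := by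
  have := mono_zeroExtensionHom M U
  refine ⟨Injective.factorThru (sheafifyDesc (LocalHom.fromZeroExtension φ))
    (sheafifyDesc (zeroExtensionHom M U)), fun V h m => ?_⟩
  have key := Injective.comp_factorThru (sheafifyDesc (LocalHom.fromZeroExtension φ))
    (sheafifyDesc (zeroExtensionHom M U))
  -- For `V ≤ U` the vanishing condition is void, so every section of `M` over `V` qualifies.
  let m' : zeroExtension M U V := ⟨m, fun hV => (hV h).elim⟩
  have e₁ := sheafifyDesc_sheafifySection (r_comp := zeroExtensionRes_comp M U)
      (zeroExtensionHom M U) V m'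
  have e₂ := sheafifyDesc_sheafifySection (r_comp := zeroExtensionRes_comp M U)
      (LocalHom.fromZeroExtension φ) V m'
  have e₃ := congr(($key).app V (sheafifySection (zeroExtensionRes M U) (zeroExtensionRes_self M U)
        (zeroExtensionRes_comp M U) V m'))
  refine (congrArg _ e₁).symm.trans (e₃.trans (e₂.trans ?_))
  exact LocalHom.fromZeroExtension_app φ h m'

theorem homSheaf_isFlasque (M I : X.Modules) [Injective I] :
    TopCat.Presheaf.IsFlasque (homSheaf M I).obj where
  epi {U V} i := (AddCommGrpCat.epi_iff_surjective _).2 fun φ => by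
    obtain ⟨ψ, hψ⟩ := LocalHom.exists_extend (M := M) (I := I) (U := V.unop) φ
    exact ⟨LocalHom.ofHom ψ U.unop, LocalHom.ext fun W h m => hψ W h m⟩

end ExtensionByZero

/-! ### The canonical isomorphism `Ext¹(M, N) ≃ H¹(X, ℋom(M, N))` -/

section CanonicalIso

open Abelian Limits

variable {X : Scheme.{u}} {M : X.Modules}

/-- A morphism as a global section of the sheaf `ℋom(M, Q)`. -/
def homSection {Q : X.Modules} (q : M ⟶ Q) :
    ((homFunctor M).obj Q).obj.obj (op (⊤ : Opens X.carrier)) := LocalHom.ofHom q ⊤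

variable (M) in
/-- The morphism `ℤ ⟶ ℋom(M, M)` given by the identity. -/
def unitHom : constInt X ⟶ (homFunctor M).obj M :=
  constHom ((homFunctor M).obj M) (homSection (𝟙 M))

theorem unitHom_comp {Q : X.Modules} (q : M ⟶ Q) :
    unitHom M ≫ (homFunctor M).map q = constHom ((homFunctor M).obj Q) (homSection q) := by
  apply constInt_hom_ext
  rw [constHom_app_constOne_top]
  exact congrArg (((homFunctor M).map q).hom.app (op ⊤))
    (constHom_app_constOne_top _ (homSection (𝟙 M)))

/-- A map out of `ℤ_X` is a global section of `ℋom(M, Q)`, that is, a morphism `M ⟶ Q`. With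
`unitHom_comp_injective` this identifies the two `Hom` groups used in dimension shifting. -/
theorem constHom_eq_unitHom_comp {Q : X.Modules} (q : constInt X ⟶ (homFunctor M).obj Q) :
    ∃ p : M ⟶ Q, q = unitHom M ≫ (homFunctor M).map p := by
  let σ : LocalHom M Q ⊤ := q.hom.app (op ⊤) (constOne ⊤)
  refine ⟨σ.toHom, ?_⟩
  rw [unitHom_comp]
  apply constInt_hom_ext
  rw [constHom_app_constOne_top]
  exact LocalHom.ext fun V _ m => (LocalHom.toHom_app σ V m).symm

theorem unitHom_comp_injective {Q : X.Modules} {p q : M ⟶ Q}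
    (h : unitHom M ≫ (homFunctor M).map p = unitHom M ≫ (homFunctor M).map q) : p = q := by
  rw [unitHom_comp, unitHom_comp] at h
  have h' := congr(($h).hom.app (op ⊤) (constOne ⊤))
  rw [constHom_app_constOne_top, constHom_app_constOne_top] at h'
  refine Scheme.Modules.hom_ext _ _ fun U => ConcreteCategory.hom_ext _ _ fun m => ?_
  exact congr(LocalHom.ev (M := M) (N := Q) (U := ⊤) $h' le_top m)

theorem mk₀_comp_mapExactFunctor (F : X.Modules ⥤ AbSheaf X.carrier) [F.Additive]
    [PreservesFiniteLimits F] [PreservesFiniteColimits F] {S : ShortComplex X.Modules}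
    (hS : S.ShortExact) {Q : X.Modules} (q : Q ⟶ S.X₃) (Z : AbSheaf X.carrier) (z : Z ⟶ F.obj Q) :
    (Ext.mk₀ z).comp (((Ext.mk₀ q).comp hS.extClass (zero_add 1)).mapExactFunctor F)
      (zero_add 1) = (Ext.mk₀ (z ≫ F.map q)).comp (hS.map_of_exact F).extClass (zero_add 1) := by
  rw [Ext.mapExactFunctor_comp, Ext.mapExactFunctor_mk₀, Ext.mapExactFunctor_extClass,
    ← Ext.mk₀_comp_mk₀]
  exact (Ext.comp_assoc (a₁₂ := 0) (a₂₃ := 1) (a := 1) _ _ _ (by lia) (by lia) (by lia)).symm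

/-- The canonical homomorphism `Ext¹(M, N) → H¹(X, ℋom(M, N))` for `M` locally free. -/
def IsLocallyFree.extToH (hM : IsLocallyFree M) (N : X.Modules) :
    Ext M N 1 →+ Sheaf.H (homSheaf M N) 1 :=
  have := hM.preservesFiniteLimits
  have := hM.preservesFiniteColimits
  ((Ext.mk₀ (unitHom M)).precomp ((homFunctor M).obj N) (zero_add 1)).comp
    ((homFunctor M).mapExtAddHom M N 1)

/-- Compatibility with dimension shifting: a class pulled back along `q` goes to the class pulled
back along the global section `q` of `ℋom(M, S.X₃)`. -/
theorem IsLocallyFree.extToH_comp_extClass (hM : IsLocallyFree M) {S : ShortComplex X.Modules}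
    (hS : S.ShortExact) (q : M ⟶ S.X₃) :
    hM.extToH S.X₁ ((Ext.mk₀ q).comp hS.extClass (zero_add 1)) =
      (Ext.mk₀ (unitHom M ≫ (homFunctor M).map q)).comp (hM.shortExact_map hS).extClass
        (zero_add 1) := by
  have := hM.preservesFiniteLimits
  have := hM.preservesFiniteColimits
  exact mk₀_comp_mapExactFunctor (homFunctor M) hS q _ (unitHom M)

/-- Write `x` as the pullback along `q : M ⟶ Q` of an injective embedding of `N`. If its image
vanishes, the section `q` lifts to `ℋom(M, I)`, so `q` itself lifts to `I` and `x = 0`. -/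
theorem IsLocallyFree.extToH_injective (hM : IsLocallyFree M) (N : X.Modules) :
    Function.Injective (hM.extToH N) := by
  refine (injective_iff_map_eq_zero _).2 fun x hx => ?_
  obtain ⟨I, Q, f, g, w, hI, hT⟩ := exists_shortExact_injective N
  obtain ⟨q, rfl⟩ := exists_comp_extClass hT x (Ext.eq_zero_of_injective _)
  have hx' := (hM.extToH_comp_extClass hT q).symm.trans hx
  obtain ⟨v, hv⟩ := exists_lift_of_comp_extClass_eq_zero (hM.shortExact_map hT) _ hx'
  obtain ⟨p, rfl⟩ := constHom_eq_unitHom_comp v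
  have : p ≫ g = q := unitHom_comp_injective (by
    rw [Functor.map_comp, ← Category.assoc]; exact hv)
  rw [← this]
  exact comp_extClass_eq_zero hT p

/-- As `H¹(X, ℋom(M, I)) = 0`, every class comes from a global section of `ℋom(M, Q)`, that is, from
a morphism `M ⟶ Q`. -/
theorem IsLocallyFree.extToH_surjective (hM : IsLocallyFree M) (N : X.Modules) :
    Function.Surjective (hM.extToH N) := by
  intro y
  obtain ⟨I, Q, f, g, w, hI, hT⟩ := exists_shortExact_injective N
  have := homSheaf_isFlasque M I
  obtain ⟨q, rfl⟩ := exists_comp_extClass (hM.shortExact_map hT) y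
    (subsingleton_H_of_isFlasque (homSheaf M I) _)
  obtain ⟨p, rfl⟩ := constHom_eq_unitHom_comp q
  exact ⟨_, hM.extToH_comp_extClass hT p⟩

/-- The canonical isomorphism `Ext¹(M, N) ≃ H¹(X, ℋom(M, N))` for `M` locally free. -/
def IsLocallyFree.extEquivH (hM : IsLocallyFree M) (N : X.Modules) :
    Ext M N 1 ≃+ Sheaf.H (homSheaf M N) 1 :=
  AddEquiv.ofBijective (hM.extToH N) ⟨hM.extToH_injective N, hM.extToH_surjective N⟩

theorem abSheaf_exists_of_isPullback {P A B C : AbSheaf X.carrier} {k : P ⟶ A} {p : P ⟶ B}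
    {g : A ⟶ C} {q : B ⟶ C} (h : IsPullback k p g q) {U : X.Opens} (a : A.obj.obj (op U))
    (b : B.obj.obj (op U)) (hab : g.hom.app (op U) a = q.hom.app (op U) b) :
    ∃ t, k.hom.app (op U) t = a ∧ p.hom.app (op U) t = b :=
  Types.exists_of_isPullback (h.map (sheafToPresheaf _ _ ⋙ (evaluation _ _).obj (op U) ⋙
    forget AddCommGrpCat.{u})) a b hab

theorem abSheaf_ext_of_isPullback {P A B C : AbSheaf X.carrier} {k : P ⟶ A} {p : P ⟶ B}
    {g : A ⟶ C} {q : B ⟶ C} (h : IsPullback k p g q) {U : X.Opens} {s t : P.obj.obj (op U)}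
    (hk : k.hom.app (op U) s = k.hom.app (op U) t) (hp : p.hom.app (op U) s = p.hom.app (op U) t) :
    s = t :=
  Types.ext_of_isPullback (h.map (sheafToPresheaf _ _ ⋙ (evaluation _ _).obj (op U) ⋙
    forget AddCommGrpCat.{u})) hk hp

/-- The representing extension of `ℤ_X` is the pullback of `ℋom(M, E) ⟶ ℋom(M, M)` along the
identity section. The splitting `s j` together with the section `1` is a section `t j` of this
pullback. -/
theorem IsLocallyFree.extEquivH_isCanonicalIso (hM : IsLocallyFree M) (N : X.Modules) :
    IsCanonicalIso M N (hM.extEquivH N) := by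
  intro E i p w hS ι U hU s c hs hc
  obtain ⟨G, f, g, k, w', hG, hfk, hk⟩ :=
    exists_pullback_shortExact (hM.shortExact_map hS) (unitHom M)
  -- This says precisely that `s j` is a splitting: it is sent to the identity of `M|_{U j}`.
  have hlift : ∀ j, ((homFunctor M).map p).hom.app (op (U j)) (s j) =
      (unitHom M).hom.app (op (U j)) (constOne (U j)) := fun j => by
    refine Eq.trans ?_ (constHom_app_constOne ((homFunctor M).obj M) (homSection (𝟙 M)) (U j)).symm
    exact LocalHom.ext fun V h m => hs j V h m
  choose t ht₁ ht₂ using fun j => abSheaf_exists_of_isPullback hk _ _ (hlift j)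
  refine ⟨hU, G, f, g, w', hG, t, ht₂, fun j l => ?_, ?_⟩
  · refine abSheaf_ext_of_isPullback hk ?_ ?_
    · have e₁ : k.hom.app _ (f.hom.app _ (c j l)) = ((homFunctor M).map i).hom.app _ (c j l) :=
        congr(($hfk).hom.app _ (c j l))
      refine e₁.trans (Eq.trans ?_ (map_sub (k.hom.app _).hom _ _).symm)
      refine Eq.trans ?_ (congrArg₂ (· - ·) (abRes_app k _ (t l)) (abRes_app k _ (t j))).symm
      rw [ht₁, ht₁]
      refine LocalHom.ext fun V h m => ?_
      exact (hc j l V h m).trans (LocalHom.sub_ev (M := M) (N := E)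
        (LocalHom.restrict inf_le_right (s l)) (LocalHom.restrict inf_le_left (s j)) h m).symm
    · refine (app_app_eq_zero w' (c j l)).trans (Eq.symm ?_)
      refine (map_sub (g.hom.app _).hom _ _).trans ?_
      refine (congrArg₂ (· - ·) (abRes_app g _ (t l)) (abRes_app g _ (t j))).trans ?_
      rw [ht₂, ht₂, abRes_constOne, abRes_constOne, sub_self]
  · refine (extClass_of_map hG (hM.shortExact_map hS) k (unitHom M) hfk hk.w).trans ?_
    have := hM.extToH_comp_extClass hS (𝟙 M)
    have e : unitHom M ≫ (homFunctor M).map (𝟙 M) = unitHom M :=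
      (congrArg _ ((homFunctor M).map_id M)).trans (Category.comp_id _)
    rw [Ext.mk₀_id_comp, e] at this
    exact this.symm

end CanonicalIso

/-! ### The two sequences over a formally smooth algebra -/

section SmoothAlgebra

variable {K : Type u} [Field K] (δ : Derivation ℤ K K) {R : Type u} [CommRing R] [Algebra K R]

/-- The kernel is the image of `H1Cotangent K R`, which vanishes for a formally smooth algebra. -/
theorem baseToAbs_injective [Algebra.FormallySmooth K R] : Function.Injective (baseToAbs K R) := by
  refine (injective_iff_map_eq_zero _).2 fun x hx => ?_
  obtain ⟨y, rfl⟩ := (Algebra.H1Cotangent.exact_δ_mapBaseChange ℤ K R x).1 hx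
  rw [Subsingleton.elim y 0, map_zero]

theorem baseToAbs_exact : Function.Exact (baseToAbs K R) (KaehlerDifferential.map ℤ K R R) :=
  KaehlerDifferential.exact_mapBaseChange_map ℤ K R

theorem absToRel_surjective : Function.Surjective (KaehlerDifferential.map ℤ K R R) :=
  KaehlerDifferential.map_surjective ℤ K R

theorem tauToRel_surjective : Function.Surjective (tauToRel δ R) := fun y => by
  obtain ⟨x, rfl⟩ := absToRel_surjective y
  exact ⟨tauProj δ R x, rfl⟩

/-- `Ω[R⁄K]` is projective, so the cotangent sequence splits; compose the contraction with a
retraction onto `R ⊗ Ω_K`. -/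
theorem exists_extend_contract [Algebra.FormallySmooth K R] :
    ∃ l : Ω[R⁄ℤ] →ₗ[R] R, ∀ x, l (baseToAbs K R x) = contract δ R x := by
  obtain ⟨s, hs⟩ := Module.projective_lifting_property (KaehlerDifferential.map ℤ K R R)
    LinearMap.id absToRel_surjective
  have h := ((baseToAbs_exact (K := K) (R := R)).split_tfae baseToAbs_injective
    absToRel_surjective).out 0 1
  obtain ⟨t, ht⟩ := h.1 ⟨s, hs⟩
  exact ⟨contract δ R ∘ₗ t, fun x => congrArg _ congr($ht x)⟩

theorem smul_tau (a b : K) : algebraMap K R (δ a) • tau δ (algebraMap K R b) =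
    algebraMap K R (δ b) • tau δ (algebraMap K R a) := by
  refine sub_eq_zero.1 ?_
  exact (Submodule.Quotient.mk_eq_zero _).2 (Submodule.subset_span ⟨(a, b), rfl⟩)

/-- On generators this is the relation `δ(e) τa = δ(a) τe` with `δ e = 1`. It is the commuting
square behind both exactness and the comparison of classes. -/
theorem tauProj_baseToAbs {e : K} (he : δ e = 1) (x : R ⊗[K] Ω[K⁄ℤ]) :
    tauProj δ R (baseToAbs K R x) = unitToTau δ R e (contract δ R x) := by
  induction x with
  | zero => simp only [map_zero]
  | add x y hx hy => simp only [map_add, hx, hy]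
  | tmul r y =>
    have h : tauProj δ R (KaehlerDifferential.map ℤ ℤ K R y) =
        algebraMap K R (δ.liftKaehlerDifferential y) • tau δ (algebraMap K R e) := by
      induction y using kaehler_induction with
      | hD a =>
        rw [KaehlerDifferential.map_D, Derivation.liftKaehlerDifferential_comp_D, smul_tau, he,
          map_one, one_smul]
        rfl
      | hadd x y hx hy => simp only [map_add, hx, hy, add_smul]
      | hsmul a x hx =>
        have : KaehlerDifferential.map ℤ ℤ K R (a • x) =
            algebraMap K R a • KaehlerDifferential.map ℤ ℤ K R x := by
          rw [map_smul, algebraMap_smul]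
        rw [this, map_smul, map_smul, hx, smul_smul, smul_eq_mul, map_mul]
    have h₁ : baseToAbs K R (r ⊗ₜ y) = r • KaehlerDifferential.map ℤ ℤ K R y :=
      KaehlerDifferential.mapBaseChange_tmul ℤ K R r y
    have h₂ : contract δ R (r ⊗ₜ y) = r * algebraMap K R (δ.liftKaehlerDifferential y) := by
      simp [contract]
    rw [h₁, h₂, map_smul, h, smul_smul]
    rfl

/-- The extended contraction `l` takes `da` to `δ(a)` for `a ∈ K`, hence kills the `τ`-relations.
The induced map sends `τe` to `1`, so it is a retraction. -/
theorem unitToTau_injective [Algebra.FormallySmooth K R] {e : K} (he : δ e = 1) :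
    Function.Injective (unitToTau δ R e) := by
  obtain ⟨l, hl⟩ := exists_extend_contract δ (R := R)
  have hD (a : K) : l (KaehlerDifferential.D ℤ R (algebraMap K R a)) = algebraMap K R (δ a) := by
    have h₁ : baseToAbs K R (1 ⊗ₜ KaehlerDifferential.D ℤ K a) =
        KaehlerDifferential.D ℤ R (algebraMap K R a) := by
      refine (KaehlerDifferential.mapBaseChange_tmul ℤ K R 1 _).trans ?_
      rw [KaehlerDifferential.map_D, one_smul]
    rw [← h₁, hl]
    simp [contract]
  let l' : TauDifferential δ R →ₗ[R] R := (tauRelations δ R).liftQ l (by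
    rw [tauRelations, Submodule.span_le]
    rintro _ ⟨p, rfl⟩
    change l _ = 0
    rw [map_sub, map_smul, map_smul, hD, hD, smul_eq_mul, smul_eq_mul, mul_comm, sub_self])
  refine Function.LeftInverse.injective (g := l') fun r => ?_
  rw [unitToTau, LinearMap.toSpanSingleton_apply, map_smul]
  change r • l (KaehlerDifferential.D ℤ R (algebraMap K R e)) = r
  rw [hD, he, map_one, smul_eq_mul, mul_one]

theorem exists_unitToTau_eq {e : K} (he : δ e = 1) {x : TauDifferential δ R}
    (hx : tauToRel δ R x = 0) : ∃ r, unitToTau δ R e r = x := by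
  obtain ⟨y, rfl⟩ := Submodule.Quotient.mk_surjective _ x
  obtain ⟨z, rfl⟩ := (baseToAbs_exact (K := K) y).1 hx
  exact ⟨_, (tauProj_baseToAbs δ he z).symm⟩

end SmoothAlgebra


/-! ### Affine opens of a smooth `K`-scheme -/

section SmoothScheme

variable {X : Scheme.{u}} {K : Type u} [Field K] [X.Over (Spec (CommRingCat.of K))]

/-- Up to an isomorphism of the base ring the `K`-algebra structure is `appLE`, so ring-theoretic
properties of the structure morphism transfer to `K → Γ(X, V)`. -/
theorem algebraMap_sections (V : X.Opens) (U : (Spec (CommRingCat.of K)).Opens) (hU : U = ⊤)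
    (h : V ≤ (X ↘ Spec (CommRingCat.of K)) ⁻¹ᵁ U) :
    ∃ f : CommRingCat.of K ≅ Γ(Spec (CommRingCat.of K), U), algebraMap K Γ(X, V) =
      ((X ↘ Spec (CommRingCat.of K)).appLE U V h).hom.comp f.hom.hom := by
  subst hU
  exact ⟨(Scheme.ΓSpecIso (.of K)).symm, rfl⟩

theorem formallySmooth_sections [Smooth (X ↘ Spec (CommRingCat.of K))] {V : X.Opens}
    (hV : IsAffineOpen V) : Algebra.FormallySmooth K Γ(X, V) := by
  obtain ⟨f, hf⟩ := algebraMap_sections (K := K) V ⊤ rfl le_top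
  have h := (X ↘ Spec (CommRingCat.of K)).smooth_appLE (isAffineOpen_top _) hV le_top
  have := RingHom.Smooth.respectsIso.2 _ f.commRingCatIsoToRingEquiv h
  rw [← RingHom.formallySmooth_algebraMap, hf]
  exact this.formallySmooth

theorem exists_isStandardSmooth_sections [Smooth (X ↘ Spec (CommRingCat.of K))] (x : X) :
    ∃ V : X.Opens, IsAffineOpen V ∧ x ∈ V ∧ Algebra.IsStandardSmooth K Γ(X, V) := by
  obtain ⟨U, -, V, hV, hx, e, h⟩ := Smooth.exists_isStandardSmooth (X ↘ Spec (.of K)) x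
  -- `Spec K` has a single point, and `U` contains the image of `x`.
  have hU : U = ⊤ := by
    refine top_le_iff.1 fun y _ => ?_
    have : Subsingleton (Spec (CommRingCat.of K)) :=
      inferInstanceAs (Subsingleton (PrimeSpectrum K))
    rw [Subsingleton.elim y ((X ↘ Spec (.of K)) x)]
    exact e hx
  obtain ⟨f, hf⟩ := algebraMap_sections V U hU e
  have := RingHom.isStandardSmooth_respectsIso.2 _ f.commRingCatIsoToRingEquiv h
  refine ⟨V, hV, hx, ?_⟩
  rw [← RingHom.isStandardSmooth_algebraMap, hf]
  exact this

theorem exists_isAffineOpen_le {U : X.Opens} {x : X} (hx : x ∈ U) :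
    ∃ V : X.Opens, IsAffineOpen V ∧ x ∈ V ∧ V ≤ U := by
  obtain ⟨V, hV, h, h'⟩ := exists_isAffineOpen_mem_and_subset hx
  exact ⟨V, hV, h, h'⟩

/-- Restriction to a basic open is a localization, hence formally étale, so differentials are
obtained by base change and a basis stays a basis. -/
theorem kaehlerMap_basis {U : X.Opens} (hU : IsAffineOpen U) (g : Γ(X, U)) {V : X.Opens}
    (hV : V = X.basicOpen g) (h : V ≤ U) {ι : Type*} [Fintype ι]
    (b : Module.Basis ι Γ(X, U) (Ω[Γ(X, U)⁄K])) :
    Function.Bijective fun a : ι → Γ(X, V) => ∑ i, a i • kaehlerMap (resAlgHom K h) (b i) := by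
  subst hV
  let := (resAlgHom K h : Γ(X, U) →+* Γ(X, X.basicOpen g)).toAlgebra
  have : IsScalarTower K Γ(X, U) Γ(X, X.basicOpen g) :=
    IsScalarTower.of_algebraMap_eq fun x => ((resAlgHom K h).commutes x).symm
  have : IsLocalization.Away g Γ(X, X.basicOpen g) := hU.isLocalization_basicOpen g
  have := Algebra.FormallyEtale.of_isLocalization (Rₘ := Γ(X, X.basicOpen g)) (.powers g)
  have hb := KaehlerDifferential.isBaseChange_of_formallyEtale K Γ(X, U) Γ(X, X.basicOpen g)
  have key (i : ι) : hb.basis b i = kaehlerMap (resAlgHom K h) (b i) := hb.basis_apply b i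
  simp only [← key]
  convert! (hb.basis b).equivFun.symm.bijective using 1
  ext a
  rw [Module.Basis.equivFun_symm_apply]

end SmoothScheme


/-! ### Checking sheafified maps on affine opens -/

section AffineSections

variable {X : Scheme.{u}}
  {M : X.Opens → Type u} [∀ U, AddCommGroup (M U)] [∀ U, Module Γ(X, U) (M U)]
  {r : ∀ {U V : X.Opens} (h : V ≤ U), M U →ₛₗ[(X.presheaf.map (homOfLE h).op).hom] M V}
  {r_id : ∀ (U : X.Opens) (m : M U), r le_rfl m = m}
  {r_comp : ∀ {U V W : X.Opens} (h : V ≤ U) (h' : W ≤ V) (m : M U),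
      r (h'.trans h) m = r h' (r h m)}
  {N : X.Opens → Type u} [∀ U, AddCommGroup (N U)] [∀ U, Module Γ(X, U) (N U)]
  {s : ∀ {U V : X.Opens} (h : V ≤ U), N U →ₛₗ[(X.presheaf.map (homOfLE h).op).hom] N V}
  {s_id : ∀ (U : X.Opens) (m : N U), s le_rfl m = m}
  {s_comp : ∀ {U V W : X.Opens} (h : V ≤ U) (h' : W ≤ V) (m : N U),
      s (h'.trans h) m = s h' (s h m)}

theorem exists_affine_sheafifySection_eq {U : X.Opens}
    (t : Γ(sheafify.obj (mkPresheaf M r r_id r_comp), U)) {x : X} (hx : x ∈ U) :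
    ∃ (V : X.Opens) (h : V ≤ U), x ∈ V ∧ IsAffineOpen V ∧
      ∃ m, sheafifySection r r_id r_comp V m = res _ h t := by
  obtain ⟨W, hW, hxW, m, hm⟩ := exists_sheafifySection_eq t hx
  obtain ⟨V, hV, hxV, hVW⟩ := exists_isAffineOpen_le hxW
  refine ⟨V, hVW.trans hW, hxV, hV, r hVW m, ?_⟩
  rw [← res_sheafifySection, hm, res_res]

theorem exists_affine_restrict_eq_zero {U : X.Opens} (m : M U)
    (hm : sheafifySection r r_id r_comp U m = 0) {x : X} (hx : x ∈ U) :
    ∃ (V : X.Opens) (h : V ≤ U), x ∈ V ∧ IsAffineOpen V ∧ r h m = 0 := by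
  obtain ⟨W, hW, hxW, hm'⟩ := exists_restrict_eq_zero m hm hx
  obtain ⟨V, hV, hxV, hVW⟩ := exists_isAffineOpen_le hxW
  exact ⟨V, hVW.trans hW, hxV, hV, by rw [r_comp hW hVW, hm', map_zero]⟩

variable (f : mkPresheaf M r r_id r_comp ⟶ mkPresheaf N s s_id s_comp)

theorem mkPresheafHom_naturality {U V : X.Opens} (h : V ≤ U) (m : M U) :
    f.app (op V) (r h m) = s h (f.app (op U) m) :=
  congr($(f.naturality (homOfLE h).op) m)

theorem sheafify_map_locally_surjective
    (hf : ∀ V : X.Opens, IsAffineOpen V → ∀ n : N V, ∃ m : M V, f.app (op V) m = n)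
    {U : X.Opens} (b : Γ(sheafify.obj (mkPresheaf N s s_id s_comp), U)) {x : X} (hx : x ∈ U) :
    ∃ (V : X.Opens) (h : V ≤ U), x ∈ V ∧ ∃ a, (sheafify.map f).app V a = res _ h b := by
  obtain ⟨V, h, hxV, hV, n, hn⟩ := exists_affine_sheafifySection_eq b hx
  obtain ⟨m, rfl⟩ := hf V hV n
  exact ⟨V, h, hxV, sheafifySection r r_id r_comp V m,
    (sheafify_map_sheafifySection f V m).trans hn⟩

/-- Represent `b` by a presheaf section; its image dies in the associated sheaf, so it becomes zero
after one further shrinking. -/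
theorem exists_mem_ker_of_sheafify_map_eq_zero {U : X.Opens}
    (b : Γ(sheafify.obj (mkPresheaf M r r_id r_comp), U)) (hb : (sheafify.map f).app U b = 0)
    {x : X} (hx : x ∈ U) :
    ∃ (V : X.Opens) (h : V ≤ U), x ∈ V ∧ IsAffineOpen V ∧
      ∃ m : M V, f.app (op V) m = (0 : N V) ∧ sheafifySection r r_id r_comp V m = res _ h b := by
  obtain ⟨W, hW, hxW, m, hm⟩ := exists_sheafifySection_eq b hx
  have h0 : sheafifySection s s_id s_comp W (f.app (op W) m) = 0 := by
    refine (sheafify_map_sheafifySection f W m).symm.trans ?_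
    rw [hm]
    refine (res_app _ hW b).trans ?_
    rw [hb]
    exact map_zero (Scheme.Modules.presheaf _ |>.map (homOfLE hW).op).hom
  obtain ⟨V, h, hxV, hV, h1⟩ := exists_affine_restrict_eq_zero _ h0 hxW
  refine ⟨V, h.trans hW, hxV, hV, r h m, (mkPresheafHom_naturality f h m).trans h1, ?_⟩
  rw [← res_sheafifySection, hm, res_res]

theorem sheafify_map_injective
    (hf : ∀ V : X.Opens, IsAffineOpen V → ∀ m : M V, f.app (op V) m = (0 : N V) → m = 0)
    (U : X.Opens) : Function.Injective ((sheafify.map f).app U) := by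
  refine (injective_iff_map_eq_zero ((sheafify.map f).app U).hom).2
    fun b hb => modules_eq_of_locally_eq _ fun x hx => ?_
  obtain ⟨V, h, hxV, hV, m, hm, hb'⟩ := exists_mem_ker_of_sheafify_map_eq_zero f b hb hx
  refine ⟨V, h, hxV, hb'.symm.trans ?_⟩
  rw [hf V hV m hm, map_zero]
  exact (map_zero (Scheme.Modules.presheaf _ |>.map (homOfLE h).op).hom).symm

end AffineSections

/-! ### A local criterion for a basis -/

section Basis

variable {X : Scheme.{u}} {M : X.Modules}

/-- Independence is a local condition on the coefficients. It makes coordinates unique, so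
coordinates that exist locally agree on overlaps and glue. -/
theorem isBasisOn_of_locally {U : X.Opens} {ι : Type*} [Fintype ι] (b : ι → Γ(M, U))
    (hinj : ∀ (V : X.Opens) (h : V ≤ U) (a : ι → Γ(X, V)), ∑ i, a i • res M h (b i) = 0 →
      ∀ x ∈ V, ∃ (W : X.Opens) (h' : W ≤ V), x ∈ W ∧
        ∀ i, X.presheaf.map (homOfLE h').op (a i) = 0)
    (hsurj : ∀ (V : X.Opens) (h : V ≤ U) (t : Γ(M, V)), ∀ x ∈ V,
      ∃ (W : X.Opens) (h' : W ≤ V), x ∈ W ∧ ∃ a : ι → Γ(X, W),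
        ∑ i, a i • res M (h'.trans h) (b i) = res M h' t) : IsBasisOn b := by
  have inj : ∀ (V : X.Opens) (h : V ≤ U) (a a' : ι → Γ(X, V)),
      ∑ i, a i • res M h (b i) = ∑ i, a' i • res M h (b i) → a = a' := by
    intro V h a a' haa'
    funext i
    refine modules_eq_of_locally_eq (structureSheaf X) (a := a i) (b := a' i) fun x hx => ?_
    obtain ⟨W, hW, hxW, h0⟩ := hinj V h (a - a') (by
      simp only [Pi.sub_apply, sub_smul, Finset.sum_sub_distrib, haa', sub_self]) x hx
    refine ⟨W, hW, hxW, sub_eq_zero.1 ?_⟩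
    exact (map_sub (X.presheaf.map (homOfLE hW).op).hom (a i) (a' i)).symm.trans (h0 i)
  refine fun V h => ⟨fun a a' => inj V h a a', fun t => ?_⟩
  choose W hW hxW a ha using fun x : V => hsurj V h t x x.2
  have hcov : iSup W = V :=
    le_antisymm (iSup_le hW) fun x hx => Opens.mem_iSup.2 ⟨⟨x, hx⟩, hxW _⟩
  have glue (i : ι) := modules_exists_glue (structureSheaf X) W hcov (fun x => a x i) fun x y => by
    refine congrFun (inj (W x ⊓ W y) ((inf_le_left.trans (hW x)).trans h)
      (fun i => X.presheaf.map (homOfLE inf_le_left).op (a x i))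
      (fun i => X.presheaf.map (homOfLE inf_le_right).op (a y i)) ?_) i
    have e₁ := res_sum_smul M (inf_le_left : W x ⊓ W y ≤ W x) (a x)
      fun i => res M ((hW x).trans h) (b i)
    have e₂ := res_sum_smul M (inf_le_right : W x ⊓ W y ≤ W y) (a y)
      fun i => res M ((hW y).trans h) (b i)
    rw [ha, res_res] at e₁ e₂
    simp only [res_res] at e₁ e₂
    exact e₁.symm.trans e₂
  choose c hc using glue
  refine ⟨c, modules_eq_of_locally_eq M fun x hx => ⟨W ⟨x, hx⟩, hW _, hxW _, ?_⟩⟩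
  refine (res_sum_smul M (hW ⟨x, hx⟩) c fun i => res M h (b i)).trans ?_
  rw [← ha]
  refine Finset.sum_congr rfl fun i _ => ?_
  rw [res_res]
  exact congrArg (· • _) (hc i ⟨x, hx⟩)

end Basis

/-! ### Sections of `Ω_{X/K}` and `Ω^τ_X`; local freeness -/

section Sections

variable {X : Scheme.{u}} {K : Type u} [Field K] [X.Over (Spec (CommRingCat.of K))]
  (δ : Derivation ℤ K K)

theorem kaehlerMap_resAlgHom_comp {U V W : X.Opens} (h : V ≤ U) (h' : W ≤ V) (m : Ω[Γ(X, U)⁄K]) :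
    kaehlerMap (resAlgHom K (h'.trans h)) m =
      kaehlerMap (resAlgHom K h') (kaehlerMap (resAlgHom K h) m) :=
  kaehlerMap_comp _ _ _ (resAlgHom_trans h h') m

theorem tauMap_resAlgHom_comp {U V W : X.Opens} (h : V ≤ U) (h' : W ≤ V)
    (m : TauDifferential δ Γ(X, U)) : tauMap δ (resAlgHom K (h'.trans h)) m =
      tauMap δ (resAlgHom K h') (tauMap δ (resAlgHom K h) m) :=
  tauMap_comp δ _ _ _ (resAlgHom_trans h h') m

theorem baseMap_resAlgHom_comp {U V W : X.Opens} (h : V ≤ U) (h' : W ≤ V)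
    (m : Γ(X, U) ⊗[K] Ω[K⁄ℤ]) : baseMap (resAlgHom K (h'.trans h)) m =
      baseMap (resAlgHom K h') (baseMap (resAlgHom K h) m) :=
  baseMap_comp _ _ _ (resAlgHom_trans h h') m

theorem kaehlerMap_toIntAlgHom_comp {U V W : X.Opens} (h : V ≤ U) (h' : W ≤ V)
    (m : Ω[Γ(X, U)⁄ℤ]) :
    kaehlerMap ((X.presheaf.map (homOfLE (h'.trans h)).op).hom).toIntAlgHom m =
      kaehlerMap ((X.presheaf.map (homOfLE h').op).hom).toIntAlgHom
        (kaehlerMap ((X.presheaf.map (homOfLE h).op).hom).toIntAlgHom m) :=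
  kaehlerMap_comp ((X.presheaf.map (homOfLE h).op).hom).toIntAlgHom
    ((X.presheaf.map (homOfLE h').op).hom).toIntAlgHom
    ((X.presheaf.map (homOfLE (h'.trans h)).op).hom).toIntAlgHom
    (fun a => congr($(X.presheaf.map_comp (homOfLE h).op (homOfLE h').op) a)) m

variable (K) in
/-- The section of `Ω_{X/K}` given by a relative differential. -/
def relSection (U : X.Opens) : Ω[Γ(X, U)⁄K] →ₗ[Γ(X, U)] Γ(omegaRel X K, U) :=
  sheafifySection (M := fun U : X.Opens => Ω[Γ(X, U)⁄K]) (fun h => kaehlerMap (resAlgHom K h))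
    (fun _ => kaehlerMap_eq_self _ resAlgHom_self) kaehlerMap_resAlgHom_comp U

/-- The section of `Ω^τ_X` given by a `τ`-differential. -/
def tauSection (U : X.Opens) : TauDifferential δ Γ(X, U) →ₗ[Γ(X, U)] Γ(omegaTau X δ, U) :=
  sheafifySection (M := fun U : X.Opens => TauDifferential δ Γ(X, U))
    (fun h => tauMap δ (resAlgHom K h))
    (fun _ => tauMap_eq_self δ _ resAlgHom_self) (tauMap_resAlgHom_comp δ) U

theorem res_relSection {U V : X.Opens} (h : V ≤ U) (m : Ω[Γ(X, U)⁄K]) :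
    res (omegaRel X K) h (relSection K U m) = relSection K V (kaehlerMap (resAlgHom K h) m) :=
  res_sheafifySection (M := fun U : X.Opens => Ω[Γ(X, U)⁄K])
    (r := fun h => kaehlerMap (resAlgHom K h))
    (r_id := fun _ => kaehlerMap_eq_self _ resAlgHom_self)
    (r_comp := kaehlerMap_resAlgHom_comp) h m

theorem res_tauSection {U V : X.Opens} (h : V ≤ U) (m : TauDifferential δ Γ(X, U)) :
    res (omegaTau X δ) h (tauSection δ U m) = tauSection δ V (tauMap δ (resAlgHom K h) m) :=
  res_sheafifySection (M := fun U : X.Opens => TauDifferential δ Γ(X, U))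
    (r := fun h => tauMap δ (resAlgHom K h))
    (r_id := fun _ => tauMap_eq_self δ _ resAlgHom_self)
    (r_comp := tauMap_resAlgHom_comp δ) h m

theorem exists_relSection_eq {U : X.Opens} (t : Γ(omegaRel X K, U)) {x : X} (hx : x ∈ U) :
    ∃ (V : X.Opens) (h : V ≤ U), x ∈ V ∧ ∃ m, relSection K V m = res (omegaRel X K) h t :=
  exists_sheafifySection_eq (M := fun U : X.Opens => Ω[Γ(X, U)⁄K])
    (r := fun h => kaehlerMap (resAlgHom K h))
    (r_id := fun _ => kaehlerMap_eq_self _ resAlgHom_self)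
    (r_comp := kaehlerMap_resAlgHom_comp) t hx

theorem exists_kaehlerMap_eq_zero {U : X.Opens} (m : Ω[Γ(X, U)⁄K]) (hm : relSection K U m = 0)
    {x : X} (hx : x ∈ U) :
    ∃ (V : X.Opens) (h : V ≤ U), x ∈ V ∧ kaehlerMap (resAlgHom K h) m = 0 :=
  exists_restrict_eq_zero (M := fun U : X.Opens => Ω[Γ(X, U)⁄K])
    (r := fun h => kaehlerMap (resAlgHom K h))
    (r_id := fun _ => kaehlerMap_eq_self _ resAlgHom_self)
    (r_comp := kaehlerMap_resAlgHom_comp) m hm hx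

theorem exists_affine_tauMap_eq_zero {U : X.Opens} (m : TauDifferential δ Γ(X, U))
    (hm : tauSection δ U m = 0) {x : X} (hx : x ∈ U) :
    ∃ (V : X.Opens) (h : V ≤ U), x ∈ V ∧ IsAffineOpen V ∧ tauMap δ (resAlgHom K h) m = 0 :=
  exists_affine_restrict_eq_zero (M := fun U : X.Opens => TauDifferential δ Γ(X, U))
    (r := fun h => tauMap δ (resAlgHom K h))
    (r_id := fun _ => tauMap_eq_self δ _ resAlgHom_self)
    (r_comp := tauMap_resAlgHom_comp δ) m hm hx

theorem unitToTauHom_app (e : K) (U : X.Opens) (a : Γ(X, U)) :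
    (unitToTauHom X δ e).app U a = tauSection δ U (unitToTau δ Γ(X, U) e a) := by
  have := (Scheme.Modules.toPresheafOfModules X).map_preimage
    (unitToTauPresheaf X δ e ≫ toSheafify (tauPresheaf X δ))
  exact congr(($this).app (op U) a)

theorem tauToRelHom_tauSection (U : X.Opens) (t : TauDifferential δ Γ(X, U)) :
    (tauToRelHom X δ).app U (tauSection δ U t) = relSection K U (tauToRel δ Γ(X, U) t) :=
  sheafify_map_sheafifySection (M := fun U : X.Opens => TauDifferential δ Γ(X, U))
    (r := fun h => tauMap δ (resAlgHom K h))
    (r_id := fun _ => tauMap_eq_self δ _ resAlgHom_self)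
    (r_comp := tauMap_resAlgHom_comp δ)
    (N := fun U : X.Opens => Ω[Γ(X, U)⁄K])
    (s := fun h => kaehlerMap (resAlgHom K h))
    (s_id := fun _ => kaehlerMap_eq_self _ resAlgHom_self)
    (s_comp := kaehlerMap_resAlgHom_comp) (tauToRelPresheaf X δ) U t

variable (X K) in
-- On a standard smooth affine open the differentials are free of finite rank. The basis survives on
-- basic opens, and these are small enough for the local criterion.
theorem isLocallyFree_omegaRel [Smooth (X ↘ Spec (CommRingCat.of K))] :
    IsLocallyFree (omegaRel X K) := by
  intro x
  obtain ⟨U, hU, hxU, h⟩ := exists_isStandardSmooth_sections (K := K) x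
  let b := (Module.Free.chooseBasis Γ(X, U) (Ω[Γ(X, U)⁄K])).reindex (Fintype.equivFin _)
  have basic : ∀ {V : X.Opens}, V ≤ U → ∀ x ∈ V, ∃ (W : X.Opens) (h : W ≤ V) (h' : W ≤ U),
      x ∈ W ∧ Function.Bijective fun a : _ → Γ(X, W) =>
        ∑ i, a i • kaehlerMap (resAlgHom K h') (b i) := fun {V} hV x hx => by
    obtain ⟨g, hg, hxg⟩ := hU.exists_basicOpen_le ⟨x, hx⟩ (hV hx)
    exact ⟨_, hg, _, hxg, kaehlerMap_basis hU g rfl (hg.trans hV) b⟩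
  have sum_eq : ∀ {V : X.Opens} (hV : V ≤ U) (a : _ → Γ(X, V)),
      ∑ i, a i • res _ hV (relSection K U (b i)) =
        relSection K V (∑ i, a i • kaehlerMap (resAlgHom K hV) (b i)) := fun hV a => by
    rw [map_sum]
    exact Finset.sum_congr rfl fun i _ => by rw [map_smul, res_relSection]
  refine ⟨U, hxU, _, fun i => relSection K U (b i),
    isBasisOn_of_locally _ (fun V hV a ha y hy => ?_) fun V hV t y hy => ?_⟩
  · rw [sum_eq] at ha
    obtain ⟨W, hW, hyW, h0⟩ :=
      exists_kaehlerMap_eq_zero _ ha hy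
    obtain ⟨W', hW', hW'U, hyW', hbij⟩ := basic (hW.trans hV) y hyW
    refine ⟨W', hW'.trans hW, hyW', fun i => ?_⟩
    refine congrFun (hbij.1 (a₁ := fun i => X.presheaf.map (homOfLE (hW'.trans hW)).op (a i))
      (a₂ := 0) ?_) i
    have h1 : kaehlerMap (resAlgHom K (hW'.trans hW))
        (∑ i, a i • kaehlerMap (resAlgHom K hV) (b i)) = 0 := by
      rw [kaehlerMap_resAlgHom_comp hW hW']
      exact (congrArg _ h0).trans (map_zero _)
    rw [map_sum] at h1
    simp only [Pi.zero_apply, zero_smul, Finset.sum_const_zero]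
    refine Eq.trans (Finset.sum_congr rfl fun i _ => ?_) h1
    rw [map_smulₛₗ, ← kaehlerMap_resAlgHom_comp hV (hW'.trans hW)]
    rfl
  · obtain ⟨W, hW, hyW, m, hm⟩ :=
      exists_relSection_eq t hy
    obtain ⟨W', hW', hW'U, hyW', hbij⟩ := basic (hW.trans hV) y hyW
    obtain ⟨a, ha⟩ := hbij.2 (kaehlerMap (resAlgHom K hW') m)
    refine ⟨W', hW'.trans hW, hyW', a, ?_⟩
    rw [sum_eq]
    refine (congrArg _ ha).trans ?_
    rw [← res_relSection, ← res_res _ hW hW']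
    exact congrArg _ hm

end Sections

/-! ### Exactness of the two sequences of sheaves -/

section ShortExact

variable (X : Scheme.{u}) {K : Type u} [Field K] [X.Over (Spec (CommRingCat.of K))]
  [Smooth (X ↘ Spec (CommRingCat.of K))] (δ : Derivation ℤ K K)

/-- Smoothness is needed only for injectivity on the left, on affine opens. The other two conditions
hold for the algebra of sections over any open. -/
theorem tauSequence_shortExact {e : K} (he : δ e = 1) : (tauSequence X δ e).ShortExact := by
  refine modules_shortExact_of_sections (fun U => ?_) (fun U b hb x hx => ?_) fun U b x hx => ?_
  · refine (injective_iff_map_eq_zero ((unitToTauHom X δ e).app U).hom).2 fun a ha =>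
      modules_eq_of_locally_eq (structureSheaf X) fun x hx => ?_
    have ha' := (unitToTauHom_app δ e U a).symm.trans ha
    obtain ⟨V, hVU, hxV, hV, h0⟩ := exists_affine_tauMap_eq_zero δ _ ha' hx
    refine ⟨V, hVU, hxV, ?_⟩
    have := formallySmooth_sections (K := K) hV
    refine (unitToTau_injective δ (R := Γ(X, V)) he (a₁ := resAlgHom K hVU a) (a₂ := 0) ?_).trans ?_
    · refine (unitToTau_natural δ e (resAlgHom K hVU) a).trans ?_
      rw [map_zero]
      exact h0
    · exact (map_zero (X.presheaf.map (homOfLE hVU).op).hom).symm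
  · obtain ⟨V, hVU, hxV, -, m, hm, hb'⟩ :=
      exists_mem_ker_of_sheafify_map_eq_zero (r_comp := by exact tauMap_resAlgHom_comp δ)
        (s_comp := by exact kaehlerMap_resAlgHom_comp) (tauToRelPresheaf X δ) b hb hx
    obtain ⟨a, rfl⟩ := exists_unitToTau_eq δ he hm
    exact ⟨V, hVU, hxV, a, (unitToTauHom_app δ e V a).trans hb'⟩
  · exact sheafify_map_locally_surjective (r_comp := by exact tauMap_resAlgHom_comp δ)
      (s_comp := by exact kaehlerMap_resAlgHom_comp) (tauToRelPresheaf X δ)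
      (fun V _ => tauToRel_surjective δ) b hx

variable (K) in
theorem cotangentSequence_shortExact : (cotangentSequence X K).ShortExact := by
  refine modules_shortExact_of_sections (fun U => ?_) (fun U b hb x hx => ?_) fun U b x hx => ?_
  · refine sheafify_map_injective (r_comp := by exact baseMap_resAlgHom_comp)
      (s_comp := by exact kaehlerMap_toIntAlgHom_comp) (baseToAbsPresheaf X K) (fun V hV m hm => ?_) U
    have := formallySmooth_sections (K := K) hV
    exact (injective_iff_map_eq_zero _).1 (baseToAbs_injective (R := Γ(X, V))) m hm
  · obtain ⟨V, hVU, hxV, -, m, hm, hb'⟩ :=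
      exists_mem_ker_of_sheafify_map_eq_zero (r_comp := by exact kaehlerMap_toIntAlgHom_comp)
        (s_comp := by exact kaehlerMap_resAlgHom_comp) (absToRelPresheaf X K) b hb hx
    obtain ⟨a, rfl⟩ := (baseToAbs_exact (K := K) m).1 hm
    refine ⟨V, hVU, hxV, sheafifySection _ _ baseMap_resAlgHom_comp V a, ?_⟩
    exact (sheafify_map_sheafifySection (r_comp := by exact baseMap_resAlgHom_comp)
      (s_comp := by exact kaehlerMap_toIntAlgHom_comp) (baseToAbsPresheaf X K) V a).trans hb'
  · exact sheafify_map_locally_surjective (r_comp := by exact kaehlerMap_toIntAlgHom_comp)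
      (s_comp := by exact kaehlerMap_resAlgHom_comp) (absToRelPresheaf X K)
      (fun V _ => absToRel_surjective) b hx

end ShortExact


/-! ### The `τ`-extension and the connecting map -/

section KodairaSpencerExt

variable (X : Scheme.{u}) {K : Type u} [Field K] [X.Over (Spec (CommRingCat.of K))]
  (δ : Derivation ℤ K K)

/-- `dr ↦ τr` -/
def tauProjPresheaf : absPresheaf X ⟶ tauPresheaf X δ :=
  mkPresheafHom (fun U => tauProj δ Γ(X, U)) (fun h => tauProj_natural δ (resAlgHom K h))

theorem tauProjPresheaf_comp :
    tauProjPresheaf X δ ≫ tauToRelPresheaf X δ = absToRelPresheaf X K :=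
  PresheafOfModules.hom_ext fun _ => ModuleCat.hom_ext (LinearMap.ext fun _ => rfl)

theorem contractHom_comp {e : K} (he : δ e = 1) :
    contractHom X δ ≫ unitToTauHom X δ e = baseToAbsHom X K ≫ sheafify.map (tauProjPresheaf X δ) := by
  refine sheafify_hom_ext (r_comp := by exact baseMap_resAlgHom_comp) fun U m => ?_
  have h₁ := sheafifyDesc_sheafifySection (r_comp := by exact baseMap_resAlgHom_comp)
    (contractPresheaf X δ) U m
  have h₂ := sheafify_map_sheafifySection (r_comp := by exact baseMap_resAlgHom_comp)
    (s_comp := by exact kaehlerMap_toIntAlgHom_comp) (baseToAbsPresheaf X K) U m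
  have h₃ := sheafify_map_sheafifySection (r_comp := by exact kaehlerMap_toIntAlgHom_comp)
    (s_comp := by exact tauMap_resAlgHom_comp δ) (tauProjPresheaf X δ) U (baseToAbs K Γ(X, U) m)
  refine (congrArg ((unitToTauHom X δ e).app U) h₁).trans ?_
  refine (unitToTauHom_app δ e U (contract δ Γ(X, U) m)).trans ?_
  refine Eq.trans ?_ (congrArg ((sheafify.map (tauProjPresheaf X δ)).app U) h₂).symm
  refine Eq.trans ?_ h₃.symm
  exact congrArg (tauSection δ U) (tauProj_baseToAbs δ he m).symm

/-- The morphism of sequences is the identity on `Ω_{X/K}` and the contraction on the left, so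
naturality expresses the `τ`-class as the image of the contraction under the connecting map. -/
theorem extClass_tauSequence {e : K} (he : δ e = 1) (hτ : (tauSequence X δ e).ShortExact)
    (hΩ : (cotangentSequence X K).ShortExact) : hτ.extClass = kodairaSpencerExt δ hΩ := by
  have h := ShortComplex.ShortExact.extClass_naturality hΩ hτ
    { τ₁ := contractHom X δ
      τ₂ := sheafify.map (tauProjPresheaf X δ)
      τ₃ := 𝟙 (omegaRel X K)
      comm₁₂ := contractHom_comp X δ he
      comm₂₃ := (sheafify.map_comp _ _).symm.trans
        ((congrArg sheafify.map (tauProjPresheaf_comp X δ)).trans (Category.comp_id _).symm) }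
  exact (h.trans (Abelian.Ext.mk₀_id_comp _)).symm

end KodairaSpencerExt

/-! ### Local splittings and uniqueness of `Φ` -/

section LocalSplittings

open Abelian

variable {X : Scheme.{u}} {M N E : X.Modules} {i : N ⟶ E} {p : E ⟶ M} {w : i ≫ p = 0}

theorem exists_cocycle_of_splittings (hS : (ShortComplex.mk i p w).ShortExact) {ι : Type u}
    {U : ι → X.Opens} (s : ∀ k, LocalHom M E (U k))
    (hs : ∀ (k : ι) (V : X.Opens) (h : V ≤ U k) (m : Γ(M, V)),
      p.app V (LocalHom.ev (s k) h m) = m) :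
    ∃ c : ∀ k l, LocalHom M N (U k ⊓ U l), ∀ (k l : ι) (V : X.Opens) (h : V ≤ U k ⊓ U l)
      (m : Γ(M, V)), i.app V (LocalHom.ev (c k l) h m) =
        LocalHom.ev (s l) (h.trans inf_le_right) m - LocalHom.ev (s k) (h.trans inf_le_left) m := by
  have key (k l : ι) := LocalHom.exists_postcomp_eq (M := M) hS (U := U k ⊓ U l)
    (LocalHom.restrict inf_le_right (s l) - LocalHom.restrict inf_le_left (s k))
    (LocalHom.ext fun V h m => by
      refine (map_sub (p.app V).hom (LocalHom.ev (s l) (h.trans inf_le_right) m)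
        (LocalHom.ev (s k) (h.trans inf_le_left) m)).trans ?_
      exact (congrArg₂ (· - ·) (hs l V _ m) (hs k V _ m)).trans (sub_self m))
  choose c hc using key
  exact ⟨c, fun k l V h m => congr(LocalHom.ev $(hc k l) h m)⟩

theorem IsLocallyFree.exists_splittings (hM : IsLocallyFree M)
    (hS : (ShortComplex.mk i p w).ShortExact) :
    ∃ (U : X → X.Opens) (_ : iSup U = ⊤) (s : ∀ k, LocalHom M E (U k)),
      ∀ (k : X) (V : X.Opens) (h : V ≤ U k) (m : Γ(M, V)),
        p.app V (LocalHom.ev (s k) h m) = m := by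
  have : Epi p := hS.epi_g
  choose U _ hxU s hs using fun x : X =>
    hM.exists_lift p (LocalHom.ofHom (𝟙 M) ⊤) (x := x) (Opens.mem_top x)
  exact ⟨U, top_le_iff.1 fun x _ => Opens.mem_iSup.2 ⟨x, hxU x⟩, s,
    fun k V h m => congr(LocalHom.ev $(hs k) h m)⟩

/-- For uniqueness: every class comes from an extension, every extension of `M` splits locally, and
the resulting cocycle represents only one class. -/
theorem IsLocallyFree.existsUnique_isCanonicalIso (hM : IsLocallyFree M) (N : X.Modules) :
    ∃! Φ, IsCanonicalIso M N Φ := by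
  refine ⟨hM.extEquivH N, hM.extEquivH_isCanonicalIso N, fun Φ hΦ => AddEquiv.ext fun x => ?_⟩
  obtain ⟨E, i, p, w, hS, rfl⟩ := exists_eq_extClass x
  obtain ⟨U, hU, s, hs⟩ := hM.exists_splittings hS
  obtain ⟨c, hc⟩ := exists_cocycle_of_splittings hS s hs
  exact (hΦ E i p w hS X U hU s c hs hc).unique
    (hM.extEquivH_isCanonicalIso N E i p w hS X U hU s c hs hc)

end LocalSplittings

/-! ### Splittings of the `τ`-sequence from derivations -/

section TauSplitting

variable {K : Type u} [Field K] (δ : Derivation ℤ K K) {R : Type u} [CommRing R] [Algebra K R]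

theorem tau_add (a b : R) : tau δ (a + b) = tau δ a + tau δ b := by
  simp only [tau, map_add]

theorem tau_mul (a b : R) : tau δ (a * b) = a • tau δ b + b • tau δ a := by
  simp only [tau, Derivation.leibniz, map_add, map_smul]

theorem tau_algebraMap {e : K} (he : δ e = 1) (a : K) :
    tau δ (algebraMap K R a) = unitToTau δ R e (algebraMap K R (δ a)) := by
  rw [unitToTau, LinearMap.toSpanSingleton_apply, smul_tau, he, map_one, one_smul]

/-- The map `a ↦ τa - D(a) τe` is a `K`-linear derivation, so it factors through `Ω[R⁄K]`. -/
theorem exists_tauSplitting {e : K} (he : δ e = 1) (D : Derivation ℤ R R)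
    (hD : ∀ a : K, D (algebraMap K R a) = algebraMap K R (δ a)) :
    ∃ σ : Ω[R⁄K] →ₗ[R] TauDifferential δ R,
      (∀ a, σ (KaehlerDifferential.D K R a) = tau δ a - unitToTau δ R e (D a)) ∧
      ∀ x, tauToRel δ R (σ x) = x := by
  let d : Derivation K R (TauDifferential δ R) := Derivation.mk'
    { toFun := fun a => tau δ a - unitToTau δ R e (D a)
      map_add' := fun a b => by
        rw [tau_add, map_add, map_add]; abel
      -- By Leibniz the obstruction to `K`-linearity is `a τk - a δ(k) τe`, which vanishes because
      -- `τk = δ(k) τe`.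
      map_smul' := fun k a => by
        rw [Algebra.smul_def, tau_mul, Derivation.leibniz, hD, map_add, tau_algebraMap δ he,
          smul_eq_mul, smul_eq_mul, ← smul_eq_mul a, map_smul, ← smul_eq_mul _ (D a), map_smul,
          RingHom.id_apply, ← algebraMap_smul R k (tau δ a - _), smul_sub]
        abel }
    (fun a b => by
      change tau δ (a * b) - unitToTau δ R e (D (a * b)) =
        a • (tau δ b - unitToTau δ R e (D b)) + b • (tau δ a - unitToTau δ R e (D a))
      rw [tau_mul, Derivation.leibniz, map_add, map_smul, map_smul, smul_sub, smul_sub]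
      abel)
  have hd (a) : d.liftKaehlerDifferential (KaehlerDifferential.D K R a) =
      tau δ a - unitToTau δ R e (D a) := Derivation.liftKaehlerDifferential_comp_D d a
  refine ⟨d.liftKaehlerDifferential, hd, fun x => ?_⟩
  induction x using kaehler_induction with
  | hD r =>
    rw [hd, map_sub, tauToRel_unitToTau, sub_zero]
    exact KaehlerDifferential.map_D ℤ K R R r
  | hadd x y hx hy => rw [map_add, map_add, hx, hy]
  | hsmul r x hx => rw [map_smul, map_smul, hx]

end TauSplitting


/-! ### Lifts of `δ` and Buium's class -/

section KodairaSpencerClass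

variable {X : Scheme.{u}} {K : Type u} [Field K] [X.Over (Spec (CommRingCat.of K))]
  {δ : Derivation ℤ K K} {e : K}

theorem universalD_add (U : X.Opens) (a b : Γ(X, U)) :
    universalD K U (a + b) = universalD K U a + universalD K U b := by
  change relSection K U _ = relSection K U _ + relSection K U _
  rw [map_add, map_add]

theorem universalD_mul (U : X.Opens) (a b : Γ(X, U)) :
    universalD K U (a * b) = a • universalD K U b + b • universalD K U a := by
  change relSection K U _ = a • relSection K U _ + b • relSection K U _
  rw [Derivation.leibniz, map_add, map_smul, map_smul]

theorem universalD_algebraMap (U : X.Opens) (a : K) :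
    universalD K U (algebraMap K Γ(X, U) a) = 0 := by
  change relSection K U _ = 0
  rw [Derivation.map_algebraMap, map_zero]

theorem res_universalD {U V : X.Opens} (h : V ≤ U) (a : Γ(X, U)) :
    res (omegaRel X K) h (universalD K U a) =
      universalD K V (X.presheaf.map (homOfLE h).op a) := by
  refine (res_relSection h _).trans ?_
  rw [kaehlerMap_D]
  rfl

theorem res_tauSection_tau {U V : X.Opens} (h : V ≤ U) (a : Γ(X, U)) :
    res (omegaTau X δ) h (tauSection δ U (tau δ a)) =
      tauSection δ V (tau δ (X.presheaf.map (homOfLE h).op a : Γ(X, V))) := by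
  refine (res_tauSection δ h _).trans (congrArg _ ?_)
  rw [tau, ← tauProj_natural, kaehlerMap_D]
  rfl

theorem exists_derivation_of_injective {R N : Type*} [CommRing R] [AddCommGroup N] [Module R N]
    (j : R →ₗ[R] N) (hj : Function.Injective j) (d : R → N) (hadd : ∀ a b, d (a + b) = d a + d b)
    (hmul : ∀ a b, d (a * b) = a • d b + b • d a) (h : ∀ a, ∃ b, j b = d a) :
    ∃ D : Derivation ℤ R R, ∀ a, j (D a) = d a := by
  choose f hf using h
  refine ⟨Derivation.mk' (AddMonoidHom.mk' f fun a b => hj ?_).toIntLinearMap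
    fun a b => hj ?_, hf⟩
  · rw [map_add, hf, hf, hf, hadd]
  · change j (f (a * b)) = j (a • f b + b • f a)
    rw [map_add, map_smul, map_smul, hf, hf, hf, hmul]

theorem LocalHom.ext_universalD {N : X.Modules} {U : X.Opens}
    {φ ψ : LocalHom (omegaRel X K) N U} (H : ∀ (V : X.Opens) (h : V ≤ U) (a : Γ(X, V)),
      LocalHom.ev φ h (universalD K V a) = LocalHom.ev ψ h (universalD K V a)) : φ = ψ := by
  refine LocalHom.ext_sheafifySection (r_comp := by exact kaehlerMap_resAlgHom_comp)
    fun V h m => ?_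
  change (LocalHom.ev φ h ∘ₗ relSection K V) m = (LocalHom.ev ψ h ∘ₗ relSection K V) m
  induction m using kaehler_induction with
  | hD a => exact H V h a
  | hadd x y hx hy => rw [map_add, map_add, hx, hy]
  | hsmul a x hx => rw [map_smul, map_smul, hx]

/-- Both `τa` and `s(da)` lie over `da`, so their difference is `D(a) τe` for a unique `D(a)`.
Additivity, the Leibniz rule and compatibility with restriction are tested after applying the
injection `r ↦ r τe`. On `K` the term `s(da)` vanishes, which leaves `D(a) = δ(a)`. -/
theorem exists_localLift_of_splitting (he : δ e = 1) (hS : (tauSequence X δ e).ShortExact)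
    {U : X.Opens} (s : LocalHom (omegaRel X K) (omegaTau X δ) U)
    (hs : ∀ (V : X.Opens) (h : V ≤ U) (m : Γ(omegaRel X K, V)),
      (tauToRelHom X δ).app V (LocalHom.ev s h m) = m) :
    ∃ D : LocalLift δ U, ∀ (V : X.Opens) (h : V ≤ U) (a : Γ(X, V)),
      tauSection δ V (unitToTau δ Γ(X, V) e (D.D h a)) =
        tauSection δ V (tau δ a) - LocalHom.ev s h (universalD K V a) := by
  have := hS.mono_f
  have inj (V : X.Opens) : Function.Injective (tauSection δ V ∘ₗ unitToTau δ Γ(X, V) e) :=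
    fun a b h => modules_app_injective (unitToTauHom X δ e) V
      (((unitToTauHom_app δ e V a).trans h).trans (unitToTauHom_app δ e V b).symm)
  have ex (V : X.Opens) (h : V ≤ U) (a : Γ(X, V)) :
      ∃ a' : Γ(X, V), tauSection δ V (unitToTau δ Γ(X, V) e a') =
        tauSection δ V (tau δ a) - LocalHom.ev s h (universalD K V a) := by
    obtain ⟨a', ha'⟩ := modules_shortExact_sections hS
      (tauSection δ V (tau δ a) - LocalHom.ev s h (universalD K V a)) (by
        refine (map_sub ((tauToRelHom X δ).app V).hom _ _).trans (sub_eq_zero.2 ?_)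
        refine (tauToRelHom_tauSection δ V _).trans (Eq.trans ?_ (hs V h _).symm)
        exact congrArg (relSection K V) (KaehlerDifferential.map_D ℤ K _ _ a))
    exact ⟨a', (unitToTauHom_app δ e V a').symm.trans ha'⟩
  have ex' (V : X.Opens) (h : V ≤ U) := exists_derivation_of_injective
    (tauSection δ V ∘ₗ unitToTau δ Γ(X, V) e) (inj V)
    (fun a => tauSection δ V (tau δ a) - LocalHom.ev s h (universalD K V a))
    (fun a b => by
      rw [universalD_add, tau_add, map_add, map_add]
      exact add_sub_add_comm _ _ _ _)
    (fun a b => by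
      rw [universalD_mul, tau_mul, map_add, map_add, map_smul, map_smul, map_smul, map_smul,
        smul_sub, smul_sub]
      exact add_sub_add_comm _ _ _ _) (ex V h)
  choose D hD using ex'
  have hD (V : X.Opens) (h : V ≤ U) (a : Γ(X, V)) :
      tauSection δ V (unitToTau δ Γ(X, V) e (D V h a)) =
        tauSection δ V (tau δ a) - LocalHom.ev s h (universalD K V a) := hD V h a
  refine ⟨⟨fun {V} h => D V h, fun {V W} h h' a => inj W ?_, fun {V} h a => inj V ?_⟩, hD⟩
  · change tauSection δ W (unitToTau δ Γ(X, W) e _) = tauSection δ W (unitToTau δ Γ(X, W) e _)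
    rw [hD, ← res_universalD, ← res_tauSection_tau, ← LocalHom.res_ev]
    refine ((congrArg (tauSection δ W) (unitToTau_natural δ e (resAlgHom K h') (D V h a))).trans
      (res_tauSection δ h' _).symm).trans ?_
    refine (congrArg (res (omegaTau X δ) h') (hD V h a)).trans ?_
    exact map_sub ((omegaTau X δ).presheaf.map (homOfLE h').op).hom _ _
  · change tauSection δ V (unitToTau δ Γ(X, V) e _) = tauSection δ V (unitToTau δ Γ(X, V) e _)
    rw [hD, universalD_algebraMap, map_zero, sub_zero, tau_algebraMap δ he]

/-- The algebraic splittings attached to `D` on the opens `V ≤ U` commute with restriction because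
`D` does, so they extend to the associated sheaf. -/
theorem exists_splitting_of_localLift (he : δ e = 1) {U : X.Opens} (D : LocalLift δ U) :
    ∃ s : LocalHom (omegaRel X K) (omegaTau X δ) U,
      (∀ (V : X.Opens) (h : V ≤ U) (m : Γ(omegaRel X K, V)),
        (tauToRelHom X δ).app V (LocalHom.ev s h m) = m) ∧
      ∀ (V : X.Opens) (h : V ≤ U) (a : Γ(X, V)), LocalHom.ev s h (universalD K V a) =
        tauSection δ V (tau δ a) - tauSection δ V (unitToTau δ Γ(X, V) e (D.D h a)) := by
  choose σ hσ hσ' using fun (V : X.Opens) (h : V ≤ U) =>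
    exists_tauSplitting δ he (D.D h) (D.D_algebraMap h)
  have compat (V W : X.Opens) (h : V ≤ U) (h' : W ≤ V) (m : Ω[Γ(X, V)⁄K]) :
      tauMap δ (resAlgHom K h') (σ V h m) =
        σ W (h'.trans h) (kaehlerMap (resAlgHom K h') m) := by
    induction m using kaehler_induction with
    | hD a =>
      rw [kaehlerMap_D, hσ, hσ, map_sub, ← unitToTau_natural, tau, ← tauProj_natural, kaehlerMap_D]
      exact congrArg (_ - unitToTau δ Γ(X, W) e ·) (D.D_res h h' a)
    | hadd x y hx hy => simp only [map_add, hx, hy]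
    | hsmul a x hx =>
      rw [map_smul, map_smulₛₗ (tauMap δ (resAlgHom K h')), map_smulₛₗ (kaehlerMap _), map_smul,
        hx]
  obtain ⟨s, hs⟩ := LocalHom.exists_of_presheaf (M := fun U : X.Opens => Ω[Γ(X, U)⁄K])
    (r := fun h => kaehlerMap (resAlgHom K h))
    (r_id := fun _ => kaehlerMap_eq_self _ resAlgHom_self)
    (r_comp := kaehlerMap_resAlgHom_comp) (N := omegaTau X δ) (U := U)
    (fun V h => tauSection δ V ∘ₗ σ V h)
    (fun V W h h' m => (res_tauSection δ h' _).trans (congrArg _ (compat V W h h' m)))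
  refine ⟨s, fun V h m => ?_, fun V h a => (hs V h _).trans ?_⟩
  · have : LocalHom.postcomp (tauToRelHom X δ) U s = LocalHom.ofHom (𝟙 (omegaRel X K)) U :=
      LocalHom.ext_sheafifySection (r_comp := by exact kaehlerMap_resAlgHom_comp)
        fun V h m => by
          refine (congrArg ((tauToRelHom X δ).app V) (hs V h m)).trans ?_
          refine (tauToRelHom_tauSection δ V (σ V h m)).trans ?_
          exact congrArg (relSection K V) (hσ' V h m)
    exact congr(LocalHom.ev $this h m)
  · refine (congrArg (tauSection δ V) (hσ V h a)).trans ?_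
    rw [map_sub]

/-- Lifts and splittings correspond and give the same cocycle. One direction compares `h` with the
class attached to the splittings built from the `D i`; the other reads lifts off from splittings
that exist by local freeness. -/
theorem isKodairaSpencerClass_iff (he : δ e = 1) (hM : IsLocallyFree (omegaRel X K))
    (hS : (tauSequence X δ e).ShortExact)
    (Φ : Abelian.Ext (omegaRel X K) (structureSheaf X) 1 ≃+
      Sheaf.H (homSheaf (omegaRel X K) (structureSheaf X)) 1)
    (hΦ : IsCanonicalIso (omegaRel X K) (structureSheaf X) Φ) (h : Sheaf.H (tangentSheaf X K) 1) :
    IsKodairaSpencerClass δ h ↔ h = Φ hS.extClass := by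
  constructor
  · rintro ⟨ι, U, D, c, hc, hrep⟩
    choose s hs hsD using fun i => exists_splitting_of_localLift (e := e) he (D i)
    have hcs (k l : ι) : LocalHom.postcomp (unitToTauHom X δ e) (U k ⊓ U l) (c k l) =
        LocalHom.restrict inf_le_right (s l) - LocalHom.restrict inf_le_left (s k) := by
      refine LocalHom.ext_universalD fun V h a => ?_
      change (unitToTauHom X δ e).app V (LocalHom.ev (c k l) h (universalD K V a)) =
        LocalHom.ev (s l) (h.trans inf_le_right) (universalD K V a) -
          LocalHom.ev (s k) (h.trans inf_le_left) (universalD K V a)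
      refine (congrArg ((unitToTauHom X δ e).app V) (hc k l V h a)).trans ?_
      refine (unitToTauHom_app δ e V _).trans ?_
      -- The signs match: `(τa - D_l(a) τe) - (τa - D_k(a) τe) = (D_k(a) - D_l(a)) τe`.
      refine Eq.trans ?_ (congrArg₂ (· - ·) (hsD l V _ a) (hsD k V _ a)).symm
      rw [map_sub, map_sub]
      abel
    exact hrep.unique (hΦ _ _ _ _ hS ι U hrep.1 s c hs
      fun k l V h m => congr(LocalHom.ev $(hcs k l) h m))
  · rintro rfl
    obtain ⟨U, hU, s, hs⟩ := hM.exists_splittings hS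
    obtain ⟨c, hc⟩ := exists_cocycle_of_splittings hS s hs
    choose D hD using fun x => exists_localLift_of_splitting he hS (s x) (hs x)
    have := hS.mono_f
    refine ⟨X, U, D, c, fun i j V hV a => ?_, hΦ _ _ _ _ hS X U hU s c hs hc⟩
    refine modules_app_injective (unitToTauHom X δ e) V ((hc i j V hV _).trans ?_)
    refine Eq.trans ?_ (unitToTauHom_app δ e V _).symm
    rw [map_sub, map_sub]
    refine Eq.trans ?_ (congrArg₂ (· - ·) (hD i V _ a) (hD j V _ a)).symm
    abel

end KodairaSpencerClass

end
end TauKS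

theorem mainTheorem11 {K : Type u} [Field K] [IsAlgClosed K] (δ : Derivation ℤ K K)
    (e : K) (he : δ e = 1) (X : Scheme.{u}) [X.Over (Spec (CommRingCat.of K))]
    [AlgebraicGeometry.IsIntegral X] [IsSeparated (X ↘ Spec (CommRingCat.of K))]
    [LocallyOfFiniteType (X ↘ Spec (CommRingCat.of K))]
    [QuasiCompact (X ↘ Spec (CommRingCat.of K))]
    [Smooth (X ↘ Spec (CommRingCat.of K))] :
    ∃ (hτ : (tauSequence X δ e).ShortExact) (hΩ : (cotangentSequence X K).ShortExact),
      hτ.extClass = kodairaSpencerExt δ hΩ ∧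
      (∃! Φ, IsCanonicalIso (omegaRel X K) (structureSheaf X) Φ) ∧
      ∀ Φ, IsCanonicalIso (omegaRel X K) (structureSheaf X) Φ →
        ∀ h : Sheaf.H (tangentSheaf X K) 1, IsKodairaSpencerClass δ h ↔ h = Φ hτ.extClass := by
  have hM := isLocallyFree_omegaRel X K
  have hτ := tauSequence_shortExact X δ he
  have hΩ := cotangentSequence_shortExact X K
  exact ⟨hτ, hΩ, extClass_tauSequence X δ he hτ hΩ, hM.existsUnique_isCanonicalIso _,
    fun Φ hΦ h => isKodairaSpencerClass_iff he hM hτ Φ hΦ h⟩
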